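/- Let $\xi$ be a centered sub-Gaussian random variable of unit variance ($\mathbb E\xi=0$, $\mathbb E|\xi|^2=1$) which is either real-valued, or of the form $\frac1{\sqrt2}(\xi'+\sqrt{-1}\,\xi'')$ with $\xi',\xi''$ iid real variables (which are then also centered and of unit variance); let $c\ge 0$ be such that $\mathbb E e^{s\xi}\le e^{cs^2/2}$ for all $s\in\mathbb R$ in the real case, respectively $\mathbb E e^{s\xi'}\le e^{cs^2/2}$ for all $s\in\mathbb R$ in the complex case. Let $(\xi_j)_{j\in\mathbb Z}$ be iid copies of $\xi$, and for $n\ge 1$ put $$P_n(x)=\frac1{\sqrt{2n+1}}\sum_{j=-n}^n \xi_j e^{\sqrt{-1}\,jx},\qquad \tilde P_n(s)=P_n(s/n)\qquad (x,s\in\mathbb R).$$ Write $\|x\|_{\mathbb R/\mathbb Z}$ for the distance from $x$ to the nearest integer. For $A>0$, a point $t\in\mathbb R$ is called $A$-smooth if $$\Big\|\frac{p\,t}{\pi n}\Big\|_{\mathbb R/\mathbb Z}>\frac An\qquad\text{for all } p\in\mathbb Z\cap[-A-1,A+1],\ p\ne0 .$$ Then for all $\kappa>0$ and $K>0$ there is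 a constant $C>0$, depending only on $\kappa$, $K$ and the sub-Gaussian constant $c$, such that for every $n\ge1$, every $n^\kappa$-smooth $t\in\mathbb R$ and every $\delta\in[n^{-K},1]$, $$\mathbb P\big(|\tilde P_n(t)|\le\delta\big)\le C\delta^2\qquad\text{and}\qquad \mathbb P\big(|\tilde P_n'(t)|\le\delta\big)\le C\delta^2 .$$ -/

import Mathlib

open MeasureTheory ProbabilityTheory
open scoped NNReal

noncomputable section

namespace SmallBall

/-- The distance `‖x‖_{ℝ/ℤ}` from a real number to the nearest integer. -/
def distInt (x : ℝ) : ℝ := |x - round x|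

/-- `t` is `A`-smooth (at level `n`): `‖p t / (π n)‖_{ℝ/ℤ} > A / n` for every nonzero integer
`p` in `[-A - 1, A + 1]`. -/
def IsSmoothPoint (n : ℕ) (A t : ℝ) : Prop :=
  ∀ p : ℤ, p ≠ 0 → |(p : ℝ)| ≤ A + 1 → A / n < distInt (p * t / (Real.pi * n))

variable {Ω : Type*} [MeasurableSpace Ω]

/-- A real random variable which is centered, has unit variance and is sub-Gaussian with
constant `c`, i.e. `E exp (s X) ≤ exp (c s ^ 2 / 2)` for all real `s`. -/
structure IsStdSubgaussian (X : Ω → ℝ) (c : ℝ≥0) (P : Measure Ω) : Prop where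
  aemeasurable : AEMeasurable X P
  mean_eq_zero : ∫ ω, X ω ∂P = 0
  variance_eq_one : Var[X; P] = 1
  subgaussian : HasSubgaussianMGF X c P

/-- The admissible coefficient variables `ξ`: centered, of unit variance and sub-Gaussian, and
either real-valued, or of the form `(ξ' + i ξ'') / √2` with `ξ'`, `ξ''` iid real variables. -/
def IsCoefficient (ξ : Ω → ℂ) (c : ℝ≥0) (P : Measure Ω) : Prop :=
  (∃ X : Ω → ℝ, IsStdSubgaussian X c P ∧ ∀ ω, ξ ω = (X ω : ℂ)) ∨
  (∃ X Y : Ω → ℝ, IsStdSubgaussian X c P ∧ IndepFun X Y P ∧ IdentDistrib X Y P P ∧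
    ∀ ω, ξ ω = ((X ω : ℂ) + Complex.I * (Y ω : ℂ)) / (Real.sqrt 2 : ℂ))

/-- The random trigonometric polynomial
`P_n(x) = (2n+1)^{-1/2} ∑_{j=-n}^{n} ξ_j e^{i j x}`, for given values `a j` of the `ξ_j`. -/
def trigPoly (n : ℕ) (a : ℤ → ℂ) (x : ℝ) : ℂ :=
  (1 / (Real.sqrt (2 * n + 1) : ℂ)) *
    ∑ j ∈ Finset.Icc (-(n : ℤ)) (n : ℤ), a j * Complex.exp (Complex.I * ((j : ℂ) * (x : ℂ)))

/-- The rescaled polynomial `s ↦ P_n(s / n)`. -/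
def scaledTrigPoly (n : ℕ) (a : ℤ → ℂ) (s : ℝ) : ℂ := trigPoly n a (s / n)

end SmallBall

end

noncomputable section

namespace SmallBall

/-! The polynomial and its derivative at `t` are sums of independent terms `d_j ξ_j`, so Esseen's
inequality in the plane (`measure_norm_le_le_integral_charFun`) reduces the bound `C δ²` to a bound,
uniform in `n`, for the integral of the modulus of a characteristic function against the weight `exp
(-δ²|u|²/2)`. Symmetrization (`prod_norm_charFun_le`) controls this modulus by sums `∑ (1 - cos (s_j
y))` with `|y|` between two positive constants. For `|u|` up to order `√n` the phases `s_j y` stay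
in `[-π, π]`, and their quadratic energy gives Gaussian decay. For larger `|u|` up to `n^(K+1)` the
numbers `s_j y / 2π` are collectively far from the integers, which gives `exp (-γ n^(κ/2))` for some
`γ > 0`, eventually below `n^(-2K) ≤ δ²`. Beyond that `δ|u| ≥ n` and the weight alone is tiny.

The intermediate range is the heart (`exists_le_distInt_affine_mul_pow`). Dirichlet's theorem gives
`p ≤ n^(κ/4)` with `ω = e^{ipt/n}` close to `1`, so high differences of `Re (z ω^l)` are small even
when `|z|` is a power of `n`. Were the sequence close to integers, the corresponding differences of
these integers would vanish, so the integers would be polynomial in `l` and their differences of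
that order with any step `q` would vanish as well. Smoothness keeps `pt/n` away from `2πℤ`, so some
`q ≤ n^(1-κ)` turns `ω^q` by an angle between `π/3` and `2π/3`; the step-`q` differences of the
sequence are then not small, a contradiction. About `n^(κ/2)` disjoint windows each contribute one
such index. -/

/-! ### Finite differences and distance to the integers. -/

/-- Iterated differences commute with additive maps. -/
theorem map_fwdDiff_iter {G H : Type*} [AddCommGroup G] [AddCommGroup H] (φ : G →+ H)
    (h k : ℕ) (g : ℕ → G) (l : ℕ) :
    (fwdDiff h)^[k] (fun i => φ (g i)) l = φ ((fwdDiff h)^[k] g l) := by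
  induction k generalizing g with
  | zero => rfl
  | succ k ih =>
    rw [Function.iterate_succ_apply, Function.iterate_succ_apply, ← ih,
      show fwdDiff h (fun i => φ (g i)) = fun i => φ (fwdDiff h g i) from
        funext fun i => by simp [fwdDiff]]

theorem fwdDiff_iter_sub {G : Type*} [AddCommGroup G] (h k : ℕ) (f g : ℕ → G) (l : ℕ) :
    (fwdDiff h)^[k] (fun i => f i - g i) l = (fwdDiff h)^[k] f l - (fwdDiff h)^[k] g l := by
  have := congrFun (fwdDiff_iter_add h (fun i => f i - g i) g k) l
  rw [show (fun i => f i - g i) + g = f from by funext i; simp] at this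
  rw [this, Pi.add_apply, add_sub_cancel_right]

theorem abs_fwdDiff_iter_le (h k N : ℕ) (g : ℕ → ℝ) (η : ℝ) (hg : ∀ i ≤ N, |g i| ≤ η)
    (l : ℕ) (hl : l + h * k ≤ N) : |(fwdDiff h)^[k] g l| ≤ 2 ^ k * η := by
  induction k generalizing l with
  | zero => simpa using hg l (by simpa using hl)
  | succ k ih =>
    rw [Function.iterate_succ_apply', fwdDiff]
    have h1 := ih (l + h) (by rw [mul_add] at hl; omega)
    have h2 := ih l (by rw [mul_add] at hl; omega)
    refine (abs_sub _ _).trans ?_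
    rw [pow_succ]; linarith

/-- If the `k`-th differences with step `1` vanish on an initial segment, then so do the `k`-th
differences with step `q`. -/
theorem fwdDiff_iter_eq_zero_of_step_one {G : Type*} [AddCommGroup G] (q k N : ℕ) (m : ℕ → G)
    (hm : ∀ l, l + k ≤ N → (fwdDiff 1)^[k] m l = 0) (l : ℕ) (hl : l + q * k ≤ N) :
    (fwdDiff q)^[k] m l = 0 := by
  induction k generalizing m N with
  | zero => exact hm l (by simpa using hl)
  | succ k ih =>
    rcases Nat.eq_zero_or_pos q with rfl | hq
    · rw [Function.iterate_succ_apply']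
      simp [fwdDiff]
    rw [Function.iterate_succ_apply]
    rw [mul_add, mul_one] at hl
    refine ih (N - q) _ (fun i hi => ?_) (by omega)
    -- One step-`q` difference is a sum of `q` shifted step-`1` differences; the shifts shrink the
    -- available range to `N - q`.
    have key : fwdDiff q m = fun i => ∑ r ∈ Finset.range q, fwdDiff 1 m (i + r) := by
      ext i
      simp only [fwdDiff]
      rw [Finset.sum_congr rfl (fun r _ => by rw [add_assoc]),
        Finset.sum_range_sub (fun r => m (i + r))]
      simp
    rw [key, show (fun i => ∑ r ∈ Finset.range q, fwdDiff 1 m (i + r))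
        = ∑ r ∈ Finset.range q, fun i => fwdDiff 1 m (i + r) from by funext i; simp,
      fwdDiff_iter_finsetSum, Finset.sum_apply]
    refine Finset.sum_eq_zero fun r hr => ?_
    rw [fwdDiff_iter_comp_add, ← Function.iterate_succ_apply]
    have := Finset.mem_range.1 hr
    exact hm _ (by omega)

/-- The second differences of an affine amplitude vanish, so in the Leibniz rule at most one
difference falls on the amplitude. The order is `k + 1` so that `(ω ^ h - 1) ^ k` factors out of
both terms. -/
theorem fwdDiff_iter_affine_mul_pow (A B ω : ℂ) (h k l : ℕ) :
    (fwdDiff h)^[k + 1] (fun i : ℕ => (A + B * i) * ω ^ i) l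
      = ω ^ l * (ω ^ h - 1) ^ k * ((A + B * l) * (ω ^ h - 1) + (k + 1) * B * h * ω ^ h) := by
  induction k generalizing l with
  | zero =>
    simp only [Function.iterate_succ_apply, Function.iterate_zero, id, fwdDiff]
    push_cast
    ring
  | succ k ih =>
    rw [Function.iterate_succ_apply', fwdDiff, ih, ih]
    push_cast
    ring

/-- A long stretch of the oscillating sequence `Re (z (A + B l) ω ^ l)` with slowly varying
phase cannot stay close to the integers. -/
theorem exists_le_distInt_affine_mul_pow (k q : ℕ) (A B : ℝ) (z ω : ℂ) (η r : ℝ)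
    (hω : ‖ω‖ = 1) (hA : 1 / 2 ≤ |A|) (hA1 : |A| ≤ 1)
    (hB : |B| * ((k + 2) * q) ≤ 1 / 100) (hr : 0 < r) (hz : r ≤ ‖z‖)
    (hβ : 1 / 2 ≤ |(ω ^ q).im|) (hβ1 : 1 ≤ ‖ω ^ q - 1‖)
    (hq : 1 ≤ q)
    (hsmall : ‖z‖ * (‖ω - 1‖ ^ k * (2 * ‖ω - 1‖ + (k + 1) * |B|)) < 1 / 4)
    (hη : 2 ^ (k + 1) * η ≤ 1 / 4) (hη1 : 2 ^ (k + 1) * η ≤ r / 100) :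
    ∃ l ≤ q * (k + 2), η ≤ distInt ((z * ((A + B * l) * ω ^ l)).re) := by
  by_contra! hcon
  set F : ℕ → ℂ := fun l => ((A : ℂ) + B * l) * ω ^ l with hF
  set φ : ℂ →+ ℝ := Complex.reAddGroupHom.comp (AddMonoidHom.mulLeft z) with hφ
  set f : ℕ → ℝ := fun l => φ (F l) with hf
  set m : ℕ → ℤ := fun l => round (f l) with hm
  set N := q * (k + 2) with hN
  have hclose : ∀ i ≤ N, |f i - (Int.castAddHom ℝ) (m i)| ≤ η := fun i hi => (hcon i hi).le
  have hBl : ∀ l ≤ N, |B| * l ≤ 1 / 100 := fun l hl => by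
    refine le_trans (mul_le_mul_of_nonneg_left ?_ (abs_nonneg B)) hB
    calc (l : ℝ) ≤ (N : ℝ) := by exact_mod_cast hl
      _ = _ := by rw [hN]; push_cast; ring
  have hdiff : ∀ h l, l + h * (k + 1) ≤ N →
      |(fwdDiff h)^[k + 1] f l - (fwdDiff h)^[k + 1] (fun i => (Int.castAddHom ℝ) (m i)) l|
        ≤ 2 ^ (k + 1) * η := fun h l hl => by
    rw [← fwdDiff_iter_sub]
    exact abs_fwdDiff_iter_le h (k + 1) N _ η hclose l hl
  -- The difference of the nearest integers is an integer of size below `1/4 + 1/4`, hence zero.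
  have hzero : ∀ l, l + (k + 1) ≤ N → (fwdDiff 1)^[k + 1] m l = 0 := fun l hl => by
    have h1 := hdiff 1 l (by simpa using hl)
    rw [map_fwdDiff_iter (Int.castAddHom ℝ)] at h1
    have h2 : |(fwdDiff 1)^[k + 1] f l| < 1 / 4 := by
      rw [hf, map_fwdDiff_iter, hF, fwdDiff_iter_affine_mul_pow]
      refine lt_of_le_of_lt (Complex.abs_re_le_norm _) (lt_of_le_of_lt ?_ hsmall)
      simp only [AddMonoidHom.mulLeft, AddMonoidHom.coe_mk, ZeroHom.coe_mk, norm_mul, norm_pow,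
        hω, one_pow, one_mul, pow_one, Nat.cast_one, mul_one]
      gcongr
      refine (norm_add_le _ _).trans ?_
      simp only [norm_mul, hω, mul_one]
      have e1 : ‖(A : ℂ) + B * l‖ ≤ 2 := by
        refine (norm_add_le _ _).trans ?_
        simp only [norm_mul, Complex.norm_real, Real.norm_eq_abs, Complex.norm_natCast]
        have := hBl l (by omega)
        linarith
      have e2 : ‖(k : ℂ) + 1‖ = k + 1 := by
        have := Complex.norm_natCast (k + 1)
        push_cast at this
        exact this
      rw [e2, Complex.norm_real, Real.norm_eq_abs]
      gcongr
    have h3 : |((((fwdDiff 1)^[k + 1] m l : ℤ)) : ℝ)| < 1 := by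
      have h1' : |(fwdDiff 1)^[k + 1] f l - (((fwdDiff 1)^[k + 1] m l : ℤ) : ℝ)| ≤ 1 / 4 :=
        h1.trans hη
      rw [abs_le] at h1'
      rw [abs_lt] at h2 ⊢
      constructor <;> linarith [h1'.1, h1'.2, h2.1, h2.2]
    exact_mod_cast Int.abs_lt_one_iff.1 (by exact_mod_cast h3)
  have hq0 : ∀ l, l + q * (k + 1) ≤ N → |(fwdDiff q)^[k + 1] f l| ≤ r / 100 := fun l hl => by
    have h1 := hdiff q l hl
    rw [map_fwdDiff_iter (Int.castAddHom ℝ), fwdDiff_iter_eq_zero_of_step_one q (k + 1) N m hzero l hl] at h1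
    simpa using h1.trans hη1
  set β := ω ^ q with hβdef
  -- The window is just long enough for step-`q` differences based at both `0` and `q`.
  have hNq : N = q + q * (k + 1) := by rw [hN]; ring
  have a0 := hq0 0 (by omega)
  have aq := hq0 q (by omega)
  rw [hf, map_fwdDiff_iter, hF, fwdDiff_iter_affine_mul_pow] at a0 aq
  simp only [hφ, AddMonoidHom.comp_apply, AddMonoidHom.mulLeft, AddMonoidHom.coe_mk,
    ZeroHom.coe_mk, Complex.coe_reAddGroupHom, ← hβdef, pow_zero, one_mul, Nat.cast_zero,
    mul_zero, add_zero] at a0 aq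
  set D := z * (β - 1) ^ k with hD
  have hβn : ‖β‖ = 1 := by rw [hβdef, norm_pow, hω, one_pow]
  have hDr : r ≤ ‖D‖ := by
    rw [hD, norm_mul, norm_pow]
    calc r ≤ ‖z‖ := hz
      _ ≤ _ := le_mul_of_one_le_right (norm_nonneg _) (one_le_pow₀ hβ1)
  have hβ2 : ‖β - 1‖ ≤ 2 := (norm_sub_le _ _).trans (by rw [hβn, norm_one]; norm_num)
  -- `W` is the main term. `V` (slope hit by a difference) and `U` (amplitude change between the
  -- base points `0` and `q`) come from the slope `B` and are a few percent of `‖D‖`.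
  set W := D * (A * (β - 1)) with hW
  have hBq : |B| * q ≤ 1 / 100 := hBl q (by omega)
  have hBkq : |B| * ((k + 1) * q) ≤ 1 / 100 := by
    refine le_trans (mul_le_mul_of_nonneg_left ?_ (abs_nonneg B)) hB
    have : (0 : ℝ) ≤ q := Nat.cast_nonneg q
    nlinarith
  have ek : ‖(k : ℂ) + 1‖ = k + 1 := by
    have := Complex.norm_natCast (k + 1)
    push_cast at this
    exact this
  set V := D * ((k + 1) * B * q * β) with hV
  have hVn : ‖V‖ ≤ ‖D‖ * (1 / 100) := by
    rw [hV, norm_mul]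
    gcongr
    simp only [norm_mul, ek, hβn, Complex.norm_real, Real.norm_eq_abs, Complex.norm_natCast]
    linarith
  set U := β * D * (B * q * (β - 1)) with hU
  have hUn : ‖U‖ ≤ ‖D‖ * (1 / 50) := by
    rw [hU, norm_mul, norm_mul, hβn, one_mul]
    gcongr
    simp only [norm_mul, Complex.norm_real, Real.norm_eq_abs, Complex.norm_natCast]
    calc |B| * q * ‖β - 1‖ ≤ 1 / 100 * 2 := by gcongr
      _ = _ := by norm_num
  have r0 : |W.re + V.re| ≤ r / 100 := by
    rw [← Complex.add_re]
    convert a0 using 3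
    rw [hW, hV, hD]; ring
  have rq : |(β * W).re + (β * V).re + U.re| ≤ r / 100 := by
    rw [← Complex.add_re, ← Complex.add_re]
    convert aq using 3
    rw [hW, hV, hU, hD]; ring
  have v0 : |V.re| ≤ ‖D‖ * (1 / 100) := (Complex.abs_re_le_norm _).trans hVn
  have vq : |(β * V).re| ≤ ‖D‖ * (1 / 100) := (Complex.abs_re_le_norm _).trans
    (by rw [norm_mul, hβn, one_mul]; exact hVn)
  have uq : |U.re| ≤ ‖D‖ * (1 / 50) := (Complex.abs_re_le_norm _).trans hUn
  have w0 : |W.re| ≤ ‖D‖ * (2 / 100) := by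
    rw [abs_le] at *
    constructor <;> linarith
  have wq : |(β * W).re| ≤ ‖D‖ * (4 / 100) := by
    rw [abs_le] at *
    constructor <;> linarith
  have hWn : ‖D‖ * (1 / 2) ≤ ‖W‖ := by
    rw [hW, norm_mul D]
    gcongr
    rw [norm_mul, Complex.norm_real, Real.norm_eq_abs]
    nlinarith
  have hre : |β.re| ≤ 1 := (Complex.abs_re_le_norm _).trans hβn.le
  -- `Re W` and `Re (β W)` are both small while `β` is far from real, so `Im W` is small too,
  -- against `‖W‖ ≥ ‖D‖ / 2`.
  have him : |W.im * β.im| ≤ ‖D‖ * (6 / 100) := by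
    have e : W.im * β.im = β.re * W.re - (β * W).re := by rw [Complex.mul_re β W]; ring
    rw [e]
    refine (abs_sub _ _).trans ?_
    rw [abs_mul]
    have : |β.re| * |W.re| ≤ 1 * |W.re| := by gcongr
    linarith
  have him' : |W.im| ≤ ‖D‖ * (12 / 100) := by
    rw [abs_mul] at him
    have : |W.im| * (1 / 2) ≤ |W.im| * |β.im| := by gcongr
    linarith
  have := Complex.norm_le_abs_re_add_abs_im W
  have hDpos : 0 < ‖D‖ := hr.trans_le hDr
  linarith

/-! ### Rotations at smooth points. -/

theorem half_le_sin_of_mem {x : ℝ} (h1 : Real.pi / 3 ≤ x) (h2 : x ≤ 2 * Real.pi / 3) :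
    1 / 2 ≤ Real.sin x := by
  have hpi := Real.pi_pos
  rw [← Real.cos_pi_div_two_sub, ← Real.cos_abs, ← Real.cos_pi_div_three]
  refine Real.cos_le_cos_of_nonneg_of_le_pi (abs_nonneg _) (by linarith) ?_
  rw [abs_le]
  constructor <;> linarith

theorem one_le_norm_exp_sub_one {x : ℝ} (h : Real.cos x ≤ 1 / 2) :
    1 ≤ ‖Complex.exp (x * Complex.I) - 1‖ := by
  have h1 : Complex.normSq (Complex.exp (x * Complex.I) - 1) = 2 - 2 * Real.cos x := by
    rw [Complex.normSq_apply, Complex.sub_re, Complex.sub_im, Complex.exp_ofReal_mul_I_re,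
      Complex.exp_ofReal_mul_I_im, Complex.one_re, Complex.one_im]
    nlinarith [Real.sin_sq_add_cos_sq x]
  rw [Complex.normSq_eq_norm_sq] at h1
  nlinarith [norm_nonneg (Complex.exp (x * Complex.I) - 1)]

/-- Near a smooth point, a short multiple `p` of the angle is a slow rotation, and a further
multiple `q` of moderate size brings it close to a quarter turn. -/
theorem IsSmoothPoint.exists_rotation {n M : ℕ} {κ t : ℝ} (hn : 1 ≤ n) (hM : 5 ≤ M)
    (hMκ : (M : ℝ) ≤ (n : ℝ) ^ κ + 1) (ht : IsSmoothPoint n ((n : ℝ) ^ κ) t) :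
    ∃ p q : ℕ, 1 ≤ p ∧ p ≤ M ∧ 1 ≤ q ∧ (q : ℝ) * (n : ℝ) ^ κ ≤ n ∧
      ‖Complex.exp (Complex.I * (p * (t / n : ℝ))) - 1‖ ≤ 7 / (M + 1) ∧
      1 / 2 ≤ |(Complex.exp (Complex.I * (p * (t / n : ℝ))) ^ q).im| ∧
      1 ≤ ‖Complex.exp (Complex.I * (p * (t / n : ℝ))) ^ q - 1‖ := by
  have hpi := Real.pi_pos
  have hn0 : (0 : ℝ) < n := by exact_mod_cast hn
  have hM5 : (5 : ℝ) ≤ M := by exact_mod_cast hM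
  obtain ⟨p, hp, hpM, hd⟩ := Real.exists_nat_abs_mul_sub_round_le (t / n / (2 * Real.pi))
    (show 0 < M by omega)
  set N := round ((p : ℝ) * (t / n / (2 * Real.pi))) with hN
  set α : ℝ := 2 * Real.pi * (p * (t / n / (2 * Real.pi)) - N) with hα
  have hαeq : α = p * (t / n) - N * (2 * Real.pi) := by rw [hα]; field_simp
  have hexp : Complex.exp (Complex.I * (p * (t / n : ℝ))) = Complex.exp (α * Complex.I) := by
    have : Complex.I * ((p : ℂ) * ((t / n : ℝ) : ℂ))
        = ((p * (t / n) - N * (2 * Real.pi) : ℝ) : ℂ) * Complex.I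
          + N * (2 * Real.pi * Complex.I) := by
      push_cast; ring
    rw [hαeq, this, Complex.exp_add, Complex.exp_int_mul_two_pi_mul_I, mul_one]
  have hαabs : |α| = 2 * Real.pi * |p * (t / n / (2 * Real.pi)) - N| := by
    rw [hα, abs_mul, abs_of_pos (by positivity)]
  have hαle : |α| ≤ 2 * Real.pi * (1 / (M + 1)) := by
    rw [hαabs]; gcongr
  have hαle3 : |α| ≤ Real.pi / 3 := by
    refine hαle.trans ?_
    have : 1 / ((M : ℝ) + 1) ≤ 1 / 6 := by
      apply one_div_le_one_div_of_le <;> linarith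
    nlinarith
  have hsm := ht p (by exact_mod_cast (by omega : p ≠ 0)) (by
    rw [Int.cast_natCast, abs_of_nonneg (Nat.cast_nonneg p)]
    exact le_trans (by exact_mod_cast hpM) hMκ)
  have hlow : Real.pi * ((n : ℝ) ^ κ / n) < |α| := by
    have h1 : distInt (((p : ℤ) : ℝ) * t / (Real.pi * n)) ≤ |α| / Real.pi := by
      -- Smoothness measures `p t / n` modulo `π`, whereas `α` is its residue modulo `2π`; hence the
      -- even integer `2 * N`.
      refine (round_le _ (2 * N)).trans (le_of_eq ?_)
      rw [hαeq, ← abs_of_pos hpi, ← abs_div, abs_of_pos hpi]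
      congr 1
      push_cast
      field_simp
    have h2 := hsm.trans_le h1
    rw [lt_div_iff₀ hpi] at h2
    linarith
  have hα0 : 0 < |α| := lt_of_le_of_lt (by positivity) hlow
  -- The first multiple of `|α|` reaching `π/3`; as `|α| ≤ π/3` (from `M ≥ 5`), it does not pass
  -- `2π/3`.
  set q := ⌈Real.pi / 3 / |α|⌉₊ with hq
  have hq1 : Real.pi / 3 ≤ q * |α| := by
    rw [← div_le_iff₀ hα0]; exact Nat.le_ceil _
  have hq2 : q * |α| ≤ 2 * Real.pi / 3 := by
    have : (q : ℝ) < Real.pi / 3 / |α| + 1 := Nat.ceil_lt_add_one (by positivity)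
    have h3 : (q : ℝ) * |α| ≤ (Real.pi / 3 / |α| + 1) * |α| := by gcongr
    rw [add_mul, div_mul_cancel₀ _ hα0.ne'] at h3
    linarith
  have hqpos : 0 < q := Nat.ceil_pos.2 (by positivity)
  have hpow : Complex.exp (α * Complex.I) ^ q = Complex.exp ((q * α : ℝ) * Complex.I) := by
    rw [← Complex.exp_nat_mul]; push_cast; ring_nf
  have habs : |(q : ℝ) * α| = q * |α| := by rw [abs_mul, abs_of_nonneg (Nat.cast_nonneg q)]
  refine ⟨p, q, hp, hpM, hqpos, ?_, ?_, ?_, ?_⟩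
  · have h4 : (q : ℝ) * (Real.pi * ((n : ℝ) ^ κ / n)) ≤ Real.pi := by
      refine (mul_le_mul_of_nonneg_left hlow.le (Nat.cast_nonneg q)).trans ?_
      linarith
    have h5 : (q : ℝ) * (n : ℝ) ^ κ / n ≤ 1 := by
      have : (q : ℝ) * (Real.pi * ((n : ℝ) ^ κ / n)) = Real.pi * (q * (n : ℝ) ^ κ / n) := by ring
      rw [this] at h4
      exact le_of_mul_le_mul_left (by linarith) hpi
    rwa [div_le_one hn0] at h5
  · rw [hexp, mul_comm]
    refine (Real.norm_exp_I_mul_ofReal_sub_one_le).trans ?_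
    rw [Real.norm_eq_abs]
    refine hαle.trans ?_
    rw [mul_one_div]
    gcongr
    linarith [Real.pi_lt_d2]
  · rw [hexp, hpow, Complex.exp_ofReal_mul_I_im]
    have : |Real.sin (q * α)| = |Real.sin (q * |α|)| := by
      rcases abs_choice α with h | h <;> rw [h]
      rw [mul_neg, Real.sin_neg, abs_neg]
    rw [this]
    exact (half_le_sin_of_mem hq1 hq2).trans (le_abs_self _)
  · rw [hexp, hpow]
    apply one_le_norm_exp_sub_one
    rw [← Real.cos_abs, habs, ← Real.cos_pi_div_three]
    exact Real.cos_le_cos_of_nonneg_of_le_pi (by positivity) (by linarith) hq1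

/-! ### Energy of the oscillating sequences and their distance to the integers. -/

/-- The real sequence `Re (z (a + b j / n) e ^ {i j θ})`. -/
def osc (n : ℕ) (a b θ : ℝ) (z : ℂ) (j : ℤ) : ℝ :=
  (z * (((a + b * (j / n) : ℝ) : ℂ) * Complex.exp (Complex.I * (j * θ)))).re

/-- Along a progression of step `p` the sequence has the form treated in
`exists_le_distInt_affine_mul_pow`, with `ω = e^{ipθ}` and slope `b p / n`. -/
theorem osc_add_mul (n : ℕ) (a b θ : ℝ) (z : ℂ) (j p l : ℕ) :
    osc n a b θ z ((j + p * l : ℕ) : ℤ)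
      = ((z * Complex.exp (Complex.I * (j * θ))) *
        ((((a + b * (j / n) : ℝ) : ℂ) + ((b * (p / n) : ℝ) : ℂ) * l) *
          Complex.exp (Complex.I * (p * θ)) ^ l)).re := by
  rw [osc, ← Complex.exp_nat_mul]
  have : Complex.exp (Complex.I * ((((j + p * l : ℕ) : ℤ) : ℂ) * θ))
      = Complex.exp (Complex.I * (j * θ)) * Complex.exp (l * (Complex.I * (p * θ))) := by
    rw [← Complex.exp_add]; push_cast; ring_nf
  rw [this]
  push_cast
  ring_nf

theorem mul_le_sum_Ico_of_windows (g : ℕ → ℝ) (hg : ∀ j, 0 ≤ g j) (e : ℝ) (n₀ H R n : ℕ)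
    (hR : n₀ + R * (H + 1) ≤ n + 1)
    (hw : ∀ m, n₀ ≤ m → m + H ≤ n → ∃ j, m ≤ j ∧ j ≤ m + H ∧ e ≤ g j) :
    R * e ≤ ∑ j ∈ Finset.Ico n₀ (n₀ + R * (H + 1)), g j := by
  induction R with
  | zero => simp
  | succ R ih =>
    have hR' : n₀ + (R + 1) * (H + 1) = n₀ + R * (H + 1) + (H + 1) := by ring
    rw [hR'] at hR ⊢
    have h1 := ih (by omega)
    obtain ⟨j, hj1, hj2, hj3⟩ := hw (n₀ + R * (H + 1)) (by omega) (by omega)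
    rw [← Finset.sum_Ico_consecutive g (show n₀ ≤ n₀ + R * (H + 1) by omega)
      (show n₀ + R * (H + 1) ≤ n₀ + R * (H + 1) + (H + 1) by omega)]
    have h2 : g j ≤ ∑ j ∈ Finset.Ico (n₀ + R * (H + 1)) (n₀ + R * (H + 1) + (H + 1)), g j :=
      Finset.single_le_sum (fun i _ => hg i) (Finset.mem_Ico.2 ⟨hj1, by omega⟩)
    push_cast
    linarith

theorem sum_Ico_nat_le_sum_Icc_int (g : ℤ → ℝ) (hg : ∀ j, 0 ≤ g j) (n₀ n₁ n : ℕ)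
    (h : n₁ ≤ n + 1) :
    ∑ j ∈ Finset.Ico n₀ n₁, g j ≤ ∑ j ∈ Finset.Icc (-(n : ℤ)) n, g j := by
  have hmap := Finset.sum_map (Finset.Ico n₀ n₁) (Nat.castEmbedding : ℕ ↪ ℤ) g
  simp only [Nat.castEmbedding_apply] at hmap
  rw [← hmap]
  refine Finset.sum_le_sum_of_subset_of_nonneg (fun j hj => ?_) (fun i _ _ => hg i)
  simp only [Finset.mem_map, Finset.mem_Ico, Nat.castEmbedding_apply] at hj
  obtain ⟨i, hi, rfl⟩ := hj
  rw [Finset.mem_Icc]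
  constructor <;> omega

/-- The two real parts are components of `W` along two directions that are quantitatively
non-parallel. -/
theorem sq_add_sq_le_of_half_le_im {β W : ℂ} (hβ : ‖β‖ = 1) (him : 1 / 2 ≤ |β.im|) :
    ‖W‖ ^ 2 / 8 ≤ W.re ^ 2 + (W * β).re ^ 2 := by
  have h1 : β.re ^ 2 + β.im ^ 2 = 1 := by
    have := Complex.sq_norm β
    rw [hβ, Complex.normSq_apply] at this
    nlinarith
  have h2 : 1 / 4 ≤ β.im ^ 2 := by
    rw [← sq_abs]; nlinarith
  rw [Complex.sq_norm, Complex.normSq_apply, Complex.mul_re]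
  set x := W.re
  set y := W.im
  set c := β.re
  set s := β.im
  have h3 : s ^ 2 * (x ^ 2 + y ^ 2) ≤ 2 * (x ^ 2 + (x * c - y * s) ^ 2) := by
    have : 2 * (x ^ 2 + (x * c - y * s) ^ 2) - s ^ 2 * (x ^ 2 + y ^ 2)
        = (c * x + (x * c - y * s)) ^ 2 + s ^ 2 * x ^ 2
          + 2 * x ^ 2 * (1 - (c ^ 2 + s ^ 2)) := by ring
    rw [h1] at this
    nlinarith [sq_nonneg (c * x + (x * c - y * s)), sq_nonneg (s * x)]
  nlinarith [sq_nonneg x, sq_nonneg y]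

theorem norm_exp_I_mul (x y : ℝ) : ‖Complex.exp (Complex.I * (x * y))‖ = 1 := by
  rw [← Complex.ofReal_mul, mul_comm, Complex.norm_exp_ofReal_mul_I]

/-- The two amplitude profiles `j ↦ a + b j / n` in use: the constant `1` and `j / n`. -/
def IsAmplitude (a b : ℝ) : Prop := (a = 1 ∧ b = 0) ∨ (a = 0 ∧ b = 1)

theorem IsAmplitude.abs_le {a b : ℝ} (h : IsAmplitude a b) : |b| ≤ 1 := by
  rcases h with ⟨_, rfl⟩ | ⟨_, rfl⟩ <;> simp

theorem IsAmplitude.mem {a b : ℝ} (h : IsAmplitude a b) {n j : ℕ} (hn : 1 ≤ n)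
    (h1 : n ≤ 2 * j) (h2 : j ≤ n) :
    1 / 2 ≤ a + b * ((j : ℝ) / n) ∧ a + b * ((j : ℝ) / n) ≤ 1 := by
  have hn0 : (0 : ℝ) < n := by exact_mod_cast hn
  have h1' : (n : ℝ) ≤ 2 * j := by exact_mod_cast h1
  have h2' : (j : ℝ) ≤ n := by exact_mod_cast h2
  rcases h with ⟨rfl, rfl⟩ | ⟨rfl, rfl⟩
  · norm_num
  · rw [zero_add, one_mul, div_le_one hn0, le_div_iff₀ hn0]
    constructor <;> linarith

/-- Indices `j` and `j + p q` differ by a rotation far from real, so together they see `‖z‖ ^ 2 /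
32`: the squared amplitude is at least `1/4` in the upper half of the range, times `1/8` from
`sq_add_sq_le_of_half_le_im`. There are at least `n / 4` such pairs, and each index is used at most
twice. -/
theorem le_sum_osc_sq {n p q : ℕ} {a b θ : ℝ} (hn : 8 ≤ n) (hab : IsAmplitude a b)
    (hpq : 8 * (p * q) ≤ n)
    (hβ : 1 / 2 ≤ |(Complex.exp (Complex.I * (p * θ)) ^ q).im|) (z : ℂ) :
    n * ‖z‖ ^ 2 / 256 ≤ ∑ j ∈ Finset.Icc (-(n : ℤ)) n, osc n a b θ z j ^ 2 := by
  set n₀ := (n + 1) / 2 with hn₀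
  set h := p * q with hh
  have hpair : ∀ j ∈ Finset.Ico n₀ (n + 1 - h), ‖z‖ ^ 2 / 32
      ≤ osc n a b θ z j ^ 2 + osc n a b θ z ((j + h : ℕ) : ℤ) ^ 2 := fun j hj => by
    rw [Finset.mem_Ico] at hj
    set β := Complex.exp (Complex.I * (p * θ)) ^ q with hβd
    have hβn : ‖β‖ = 1 := by
      rw [hβd, norm_pow, ← Complex.ofReal_natCast, norm_exp_I_mul, one_pow]
    set W := z * Complex.exp (Complex.I * (j * θ)) with hW
    have hWn : ‖W‖ = ‖z‖ := by
      rw [hW, norm_mul, ← Complex.ofReal_natCast, norm_exp_I_mul, mul_one]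
    have e1 : osc n a b θ z j = (a + b * ((j : ℝ) / n)) * W.re := by
      have := osc_add_mul n a b θ z j 0 0
      simp only [mul_zero, add_zero] at this
      rw [this, ← Complex.re_ofReal_mul, hW]
      congr 1; simp; ring
    have e2 : osc n a b θ z ((j + h : ℕ) : ℤ)
        = (a + b * (((j + h : ℕ) : ℝ) / n)) * (W * β).re := by
      rw [hh, osc_add_mul, ← hβd, ← hW, ← Complex.re_ofReal_mul]
      congr 1; push_cast; ring
    rw [e1, e2, mul_pow, mul_pow]
    have a1 := (hab.mem (n := n) (j := j) (by omega) (by omega) (by omega)).1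
    have a2 := (hab.mem (n := n) (j := j + h) (by omega) (by omega) (by omega)).1
    have b1 : 1 / 4 ≤ (a + b * ((j : ℝ) / n)) ^ 2 := by nlinarith
    have b2 : 1 / 4 ≤ (a + b * (((j + h : ℕ) : ℝ) / n)) ^ 2 := by nlinarith
    have key := sq_add_sq_le_of_half_le_im (W := W) hβn hβ
    rw [hWn] at key
    nlinarith [mul_le_mul_of_nonneg_right b1 (sq_nonneg W.re),
      mul_le_mul_of_nonneg_right b2 (sq_nonneg (W * β).re)]
  have hsum := Finset.card_nsmul_le_sum _ _ _ hpair
  rw [Nat.card_Ico, Finset.sum_add_distrib, nsmul_eq_mul] at hsum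
  have s1 : ∑ j ∈ Finset.Ico n₀ (n + 1 - h), osc n a b θ z j ^ 2
      ≤ ∑ j ∈ Finset.Icc (-(n : ℤ)) n, osc n a b θ z j ^ 2 :=
    sum_Ico_nat_le_sum_Icc_int (fun j => osc n a b θ z j ^ 2) (fun _ => sq_nonneg _) _ _ _
      (by omega)
  have s2 : ∑ j ∈ Finset.Ico n₀ (n + 1 - h), osc n a b θ z ((j + h : ℕ) : ℤ) ^ 2
      ≤ ∑ j ∈ Finset.Icc (-(n : ℤ)) n, osc n a b θ z j ^ 2 := by
    rw [Finset.sum_Ico_add' (fun j : ℕ => osc n a b θ z (j : ℤ) ^ 2)]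
    exact sum_Ico_nat_le_sum_Icc_int (fun j => osc n a b θ z j ^ 2) (fun _ => sq_nonneg _) _ _ _
      (by omega)
  have hc : (n : ℝ) / 4 ≤ ((n + 1 - h - n₀ : ℕ) : ℝ) := by
    have : n ≤ 4 * (n + 1 - h - n₀) := by omega
    have : (n : ℝ) ≤ 4 * ((n + 1 - h - n₀ : ℕ) : ℝ) := by exact_mod_cast this
    linarith
  have hmul : (n : ℝ) / 4 * (‖z‖ ^ 2 / 32) ≤ ((n + 1 - h - n₀ : ℕ) : ℝ) * (‖z‖ ^ 2 / 32) := by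
    gcongr
  linarith

/-- Indices run over `n / 2 ≤ j ≤ n`, where both amplitude profiles lie in `[1/2, 1]`; `R` disjoint
windows of length `p q (k + 2) + 1` fit there, and each holds an index at distance at least `η` from
the integers. -/
theorem le_sum_distInt_osc_sq {n p q k R : ℕ} {a b θ η r : ℝ} (hn : 1 ≤ n)
    (hab : IsAmplitude a b) (hq : 1 ≤ q)
    (hβ : 1 / 2 ≤ |(Complex.exp (Complex.I * (p * θ)) ^ q).im|)
    (hβ1 : 1 ≤ ‖Complex.exp (Complex.I * (p * θ)) ^ q - 1‖)
    (hB : (p : ℝ) / n * ((k + 2) * q) ≤ 1 / 100)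
    (hR : 2 * (R * (p * q * (k + 2) + 1)) ≤ n) (hr : 0 < r) (hη0 : 0 ≤ η)
    (hη : 2 ^ (k + 1) * η ≤ 1 / 4) (hη1 : 2 ^ (k + 1) * η ≤ r / 100)
    (z : ℂ) (hz : r ≤ ‖z‖)
    (hsmall : ‖z‖ * (‖Complex.exp (Complex.I * (p * θ)) - 1‖ ^ k *
      (2 * ‖Complex.exp (Complex.I * (p * θ)) - 1‖ + (k + 1) * (p / n))) < 1 / 4) :
    R * η ^ 2 ≤ ∑ j ∈ Finset.Icc (-(n : ℤ)) n, distInt (osc n a b θ z j) ^ 2 := by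
  set n₀ := (n + 1) / 2 with hn₀
  set ω := Complex.exp (Complex.I * (p * θ)) with hω
  have hωn : ‖ω‖ = 1 := by rw [hω, ← Complex.ofReal_natCast, norm_exp_I_mul]
  have hBle : |b * (p / n)| ≤ p / n := by
    rw [abs_mul, abs_of_nonneg (by positivity : (0 : ℝ) ≤ (p : ℝ) / n)]
    exact mul_le_of_le_one_left (by positivity) hab.abs_le
  have hwin : ∀ m, n₀ ≤ m → m + p * q * (k + 2) ≤ n →
      ∃ j, m ≤ j ∧ j ≤ m + p * q * (k + 2) ∧ η ^ 2 ≤ distInt (osc n a b θ z (j : ℤ)) ^ 2 :=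
    fun m hm1 hm2 => by
    obtain ⟨hA1, hA2⟩ := hab.mem (n := n) (j := m) hn (by omega) (by omega)
    have hzn : ‖z * Complex.exp (Complex.I * (m * θ))‖ = ‖z‖ := by
      rw [norm_mul, ← Complex.ofReal_natCast, norm_exp_I_mul, mul_one]
    obtain ⟨l, hl, hle⟩ := exists_le_distInt_affine_mul_pow k q (a + b * ((m : ℝ) / n))
      (b * (p / n)) (z * Complex.exp (Complex.I * (m * θ))) ω η r hωn
      (hA1.trans (le_abs_self _)) (abs_le.2 ⟨by linarith, hA2⟩)
      ((mul_le_mul_of_nonneg_right hBle (by positivity)).trans hB) hr (by rw [hzn]; exact hz)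
      hβ hβ1 hq (by
        rw [hzn]
        refine lt_of_le_of_lt ?_ hsmall
        gcongr) hη hη1
    refine ⟨m + p * l, by omega, ?_, ?_⟩
    · have : p * l ≤ p * (q * (k + 2)) := Nat.mul_le_mul_left p hl
      rw [← mul_assoc] at this
      omega
    · rw [osc_add_mul]
      exact pow_le_pow_left₀ hη0 hle 2
  refine (mul_le_sum_Ico_of_windows (fun j : ℕ => distInt (osc n a b θ z (j : ℤ)) ^ 2)
    (fun _ => sq_nonneg _) _ n₀ (p * q * (k + 2)) R n (by omega) hwin).trans ?_
  exact sum_Ico_nat_le_sum_Icc_int (fun j => distInt (osc n a b θ z j) ^ 2)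
    (fun _ => sq_nonneg _) _ _ _ (by omega)

/-- The power `x ^ k` beats `n ^ K` with a factor `n` to spare, which absorbs the constants
depending on `k`. -/
theorem mul_pow_mul_lt_quarter {n x K w v y : ℝ} {k : ℕ} (hn : 0 < n) (hx : 0 < x) (hw : 0 ≤ w)
    (hwx : w ≤ 7 / x) (hw7 : w ≤ 7) (hv : 0 ≤ v) (hv1 : v ≤ 1) (hy : y ≤ n ^ K)
    (hxk : n ^ (K + 1) ≤ x ^ k) (hbig : 4 * (7 ^ k * (15 + k) : ℝ) < n) :
    y * (w ^ k * (2 * w + (k + 1) * v)) < 1 / 4 := by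
  calc y * (w ^ k * (2 * w + (k + 1) * v))
      ≤ n ^ K * ((7 / x) ^ k * (2 * 7 + (k + 1) * 1)) := by gcongr
    _ = n ^ K * (7 ^ k * (15 + k)) / x ^ k := by rw [div_pow]; ring
    _ ≤ n ^ K * (7 ^ k * (15 + k)) / n ^ (K + 1) := by gcongr
    _ = (7 ^ k * (15 + k)) / n := by
      rw [Real.rpow_add hn, Real.rpow_one]; field_simp
    _ < 1 / 4 := by rw [div_lt_iff₀ hn]; linarith

/-- Used with `x = n ^ (κ / 4)`: then `p ≤ x` and `q ≤ n / x ^ 4` leave a factor `x ^ 3` between `p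
q` and `n`, enough for `x ^ 2` windows. -/
theorem rotation_scale_bounds {n x : ℝ} {k p q : ℕ} (hn : 0 < n) (hx : 100 * ((k : ℝ) + 2) ≤ x)
    (hp : 1 ≤ p) (hq : 1 ≤ q) (hpx : (p : ℝ) ≤ x) (hqn : q * x ^ 4 ≤ n) :
    (p : ℝ) * q * x ^ 3 ≤ n ∧ (p : ℝ) / n ≤ 1 ∧ 8 * ((p : ℝ) * q) ≤ n ∧
      (p : ℝ) / n * ((k + 2) * q) ≤ 1 / 100 := by
  have hk0 : (0 : ℝ) ≤ k := Nat.cast_nonneg k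
  have hx1 : 100 ≤ x := by linarith
  have hq1' : (1 : ℝ) ≤ q := by exact_mod_cast hq
  have hp1' : (1 : ℝ) ≤ p := by exact_mod_cast hp
  have hpq : (p : ℝ) * q * x ^ 3 ≤ n := by
    calc (p : ℝ) * q * x ^ 3 ≤ x * q * x ^ 3 := by gcongr
      _ = q * x ^ 4 := by ring
      _ ≤ n := hqn
  have hpqx : (p : ℝ) * q * x * 10000 ≤ n := by
    refine le_trans ?_ hpq
    have : (10000 : ℝ) ≤ x ^ 2 := by nlinarith
    calc (p : ℝ) * q * x * 10000 ≤ (p : ℝ) * q * x * x ^ 2 := by gcongr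
      _ = _ := by ring
  have hpp : (p : ℝ) ≤ p * q := le_mul_of_one_le_right (by linarith) hq1'
  have hppx : (p : ℝ) * q ≤ p * q * x := le_mul_of_one_le_right (by positivity) (by linarith)
  refine ⟨hpq, ?_, by linarith, ?_⟩
  · rw [div_le_one hn]
    linarith
  · rw [div_mul_eq_mul_div, div_le_iff₀ hn]
    have : (p : ℝ) * q * (100 * (k + 2)) ≤ p * q * x := by gcongr
    linarith

theorem two_mul_ceil_sq_mul_le {n x : ℝ} {k p q : ℕ} (hx : 100 * ((k : ℝ) + 2) ≤ x)
    (hp : 1 ≤ p) (hq : 1 ≤ q) (hpq : (p : ℝ) * q * x ^ 3 ≤ n) :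
    (2 : ℝ) * (⌈x ^ 2⌉₊ * (p * q * (k + 2) + 1)) ≤ n := by
  have hk0 : (0 : ℝ) ≤ k := Nat.cast_nonneg k
  have hR2 : (⌈x ^ 2⌉₊ : ℝ) ≤ 2 * x ^ 2 := by
    have := Nat.ceil_lt_add_one (show 0 ≤ x ^ 2 by positivity)
    nlinarith
  have h1 : (1 : ℝ) ≤ p * q := by exact_mod_cast Nat.mul_pos hp hq
  calc (2 : ℝ) * (⌈x ^ 2⌉₊ * (p * q * (k + 2) + 1))
      ≤ 2 * (2 * x ^ 2 * (p * q * (k + 2) + p * q)) := by gcongr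
    _ = p * q * x ^ 2 * (4 * (k + 3)) := by ring
    _ ≤ p * q * x ^ 2 * x := by gcongr; linarith
    _ = p * q * x ^ 3 := by ring
    _ ≤ n := hpq

open Filter in
/-- At a smooth point the oscillating sequences `osc` have full energy and, for amplitudes
between a constant and a power of `n`, stay far from the integers. -/
theorem eventually_osc_bounds {κ K r : ℝ} (hκ : 0 < κ) (hr : 0 < r) :
    ∃ η : ℝ, 0 < η ∧ ∀ᶠ n : ℕ in atTop, ∀ t, IsSmoothPoint n ((n : ℝ) ^ κ) t →
      ∀ a b, IsAmplitude a b →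
      (∀ z, n * ‖z‖ ^ 2 / 256 ≤ ∑ j ∈ Finset.Icc (-(n : ℤ)) n, osc n a b (t / n) z j ^ 2) ∧
      ∀ z, r ≤ ‖z‖ → ‖z‖ ≤ (n : ℝ) ^ K →
        η * (n : ℝ) ^ (κ / 2)
          ≤ ∑ j ∈ Finset.Icc (-(n : ℤ)) n, distInt (osc n a b (t / n) z j) ^ 2 := by
  -- The order of differencing is such that `(n ^ (κ / 4)) ^ k ≥ n ^ (K + 1)`.
  obtain ⟨k, hk⟩ := exists_nat_ge ((K + 1) / (κ / 4))
  rw [div_le_iff₀ (by positivity)] at hk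
  set η : ℝ := min (1 / 4) (r / 100) / 2 ^ (k + 1) with hη
  have hη0 : 0 < η := by positivity
  have hη' : 2 ^ (k + 1) * η = min (1 / 4) (r / 100) := by rw [hη]; field_simp
  refine ⟨η ^ 2, by positivity, ?_⟩
  have hx : Tendsto (fun n : ℕ => (n : ℝ) ^ (κ / 4)) atTop atTop :=
    (tendsto_rpow_atTop (by positivity)).comp tendsto_natCast_atTop_atTop
  filter_upwards [hx.eventually_ge_atTop (100 * (k + 2)), eventually_ge_atTop 8,
    tendsto_natCast_atTop_atTop.eventually_gt_atTop (4 * (7 ^ k * (15 + k) : ℝ))]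
    with n hxn hn8 hnbig t ht a b hab
  set x := (n : ℝ) ^ (κ / 4) with hxdef
  have hn0 : (0 : ℝ) < n := by exact_mod_cast (by omega : 0 < n)
  have hn1 : (1 : ℝ) ≤ n := by exact_mod_cast (by omega : 1 ≤ n)
  have hk0 : (0 : ℝ) ≤ k := Nat.cast_nonneg k
  have hx1 : 100 ≤ x := by linarith
  have hxpos : 0 < x := by linarith
  have hx4 : (n : ℝ) ^ κ = x ^ 4 := by
    rw [hxdef, ← Real.rpow_mul_natCast hn0.le]; congr 1; push_cast; ring
  have hx2 : (n : ℝ) ^ (κ / 2) = x ^ 2 := by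
    rw [hxdef, ← Real.rpow_mul_natCast hn0.le]; congr 1; push_cast; ring
  have hxk : (n : ℝ) ^ (K + 1) ≤ x ^ k := by
    rw [hxdef, ← Real.rpow_mul_natCast hn0.le]
    exact Real.rpow_le_rpow_of_exponent_le hn1 (by linarith)
  have hMx : (⌊x⌋₊ : ℝ) ≤ x := Nat.floor_le hxpos.le
  have hxM : x ≤ ⌊x⌋₊ + 1 := (Nat.lt_floor_add_one x).le
  have hxx4 : x ≤ x ^ 4 := le_self_pow₀ (by linarith) (by norm_num)
  obtain ⟨p, q, hp1, hpM, hq1, hqn, hω, hβ, hβ1⟩ := ht.exists_rotation (M := ⌊x⌋₊) (by omega)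
    (Nat.le_floor (by push_cast; linarith)) (by rw [hx4]; linarith)
  rw [hx4] at hqn
  have hpx : (p : ℝ) ≤ x := le_trans (by exact_mod_cast hpM) hMx
  obtain ⟨hpq, hpn, hpq8, hB⟩ := rotation_scale_bounds hn0 hxn hp1 hq1 hpx hqn
  refine ⟨fun z => le_sum_osc_sq hn8 hab (by exact_mod_cast hpq8) hβ z, fun z hz1 hz2 => ?_⟩
  have hRn := two_mul_ceil_sq_mul_le hxn hp1 hq1 hpq
  have hω' : ‖Complex.exp (Complex.I * (p * (t / n : ℝ))) - 1‖ ≤ 7 / x :=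
    hω.trans (by gcongr)
  have hω2 : ‖Complex.exp (Complex.I * (p * (t / n : ℝ))) - 1‖ ≤ 7 :=
    hω'.trans (div_le_self (by norm_num) (by linarith))
  have hfin := le_sum_distInt_osc_sq (n := n) (R := ⌈x ^ 2⌉₊) (η := η) (by omega) hab hq1 hβ hβ1
    hB (by exact_mod_cast hRn) hr hη0.le (hη'.le.trans (min_le_left _ _))
    (hη'.le.trans (min_le_right _ _)) z hz1
    (mul_pow_mul_lt_quarter hn0 hxpos (norm_nonneg _) hω' hω2 (by positivity) hpn hz2 hxk hnbig)
  refine le_trans ?_ hfin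
  rw [hx2, mul_comm]
  exact mul_le_mul_of_nonneg_right (Nat.le_ceil _) (sq_nonneg η)

/-! ### Characteristic functions and symmetrization. -/

theorem norm_charFun_sq_eq_integral_cos (ν : Measure ℝ) [IsProbabilityMeasure ν] (s : ℝ) :
    ‖charFun ν s‖ ^ 2 = ∫ p : ℝ × ℝ, Real.cos (s * (p.1 - p.2)) ∂(ν.prod ν) := by
  have h1 : charFun ν s * charFun ν (-s)
      = ∫ p : ℝ × ℝ, Complex.exp ((s * (p.1 - p.2) : ℝ) * Complex.I) ∂(ν.prod ν) := by
    rw [charFun_apply_real, charFun_apply_real, ← integral_prod_mul]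
    congr 1
    ext p
    rw [← Complex.exp_add]
    push_cast
    ring_nf
  rw [charFun_neg, Complex.mul_conj, Complex.normSq_eq_norm_sq] at h1
  have hint : Integrable
      (fun p : ℝ × ℝ => Complex.exp ((s * (p.1 - p.2) : ℝ) * Complex.I)) (ν.prod ν) := by
    refine Integrable.of_bound (Continuous.aestronglyMeasurable (by fun_prop)) 1 ?_
    exact Filter.Eventually.of_forall fun p => (Complex.norm_exp_ofReal_mul_I _).le
  have h2 := congrArg Complex.re h1
  rw [Complex.ofReal_re] at h2
  rw [h2, ← RCLike.re_eq_complex_re, ← integral_re hint]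
  simp only [RCLike.re_eq_complex_re, Complex.exp_ofReal_mul_I_re]

theorem integrable_cos_mul_sub (ν : Measure ℝ) [IsProbabilityMeasure ν] (s : ℝ) :
    Integrable (fun p : ℝ × ℝ => Real.cos (s * (p.1 - p.2))) (ν.prod ν) :=
  Integrable.of_bound (Continuous.aestronglyMeasurable (by fun_prop)) 1
    (Filter.Eventually.of_forall fun p => by simpa using Real.abs_cos_le_one _)

theorem measurableSet_symm (b : ℝ) :
    MeasurableSet {p : ℝ × ℝ | 1 ≤ |p.1 - p.2| ∧ |p.1 - p.2| ≤ b} := by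
  have h : Measurable fun p : ℝ × ℝ => |p.1 - p.2| :=
    Continuous.measurable (by fun_prop)
  exact (measurableSet_le measurable_const h).inter (measurableSet_le h measurable_const)

theorem integrable_one_sub_cos (ν : Measure ℝ) [IsProbabilityMeasure ν] (s : ℝ) :
    Integrable (fun p : ℝ × ℝ => 1 - Real.cos (s * (p.1 - p.2))) (ν.prod ν) :=
  (integrable_const 1).sub (integrable_cos_mul_sub ν s)

/-- If the symmetrized variable is of constant order with probability `q`, then a product of
characteristic functions is controlled by the values of `∑ (1 - cos (s j * y))`. -/
theorem prod_norm_charFun_le {ι : Type*} (ν : Measure ℝ) [IsProbabilityMeasure ν] (S : Finset ι)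
    (s : ι → ℝ) {b q L : ℝ} (hL : 0 ≤ L)
    (hq : q ≤ (ν.prod ν).real {p | 1 ≤ |p.1 - p.2| ∧ |p.1 - p.2| ≤ b})
    (hs : ∀ y, 1 ≤ |y| → |y| ≤ b → L ≤ ∑ j ∈ S, (1 - Real.cos (s j * y))) :
    ∏ j ∈ S, ‖charFun ν (s j)‖ ≤ Real.exp (-(q * L / 2)) := by
  -- From `v ≤ (1 + v²) / 2 = 1 - (1 - v²) / 2`.
  have h1 : ∀ j ∈ S, ‖charFun ν (s j)‖ ≤ Real.exp (-((1 - ‖charFun ν (s j)‖ ^ 2) / 2)) :=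
    fun j _ => by
    refine le_trans ?_ (Real.add_one_le_exp _)
    nlinarith [sq_nonneg (1 - ‖charFun ν (s j)‖)]
  refine (Finset.prod_le_prod (fun j _ => norm_nonneg _) h1).trans ?_
  rw [← Real.exp_sum, Real.exp_le_exp, Finset.sum_neg_distrib, neg_le_neg_iff,
    ← Finset.sum_div]
  have hE : MeasurableSet {p : ℝ × ℝ | 1 ≤ |p.1 - p.2| ∧ |p.1 - p.2| ≤ b} := measurableSet_symm b
  have h2 : ∑ j ∈ S, (1 - ‖charFun ν (s j)‖ ^ 2)
      = ∫ p : ℝ × ℝ, ∑ j ∈ S, (1 - Real.cos (s j * (p.1 - p.2))) ∂(ν.prod ν) := by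
    rw [integral_finsetSum _ fun j _ => integrable_one_sub_cos ν (s j)]
    refine Finset.sum_congr rfl fun j _ => ?_
    rw [integral_sub (integrable_const _) (integrable_cos_mul_sub ν _),
      norm_charFun_sq_eq_integral_cos]
    simp
  have h3 : (ν.prod ν).real {p | 1 ≤ |p.1 - p.2| ∧ |p.1 - p.2| ≤ b} * L
      ≤ ∫ p : ℝ × ℝ, ∑ j ∈ S, (1 - Real.cos (s j * (p.1 - p.2))) ∂(ν.prod ν) := by
    rw [← smul_eq_mul, ← integral_indicator_const _ hE]
    refine integral_mono ((integrable_const L).indicator hE)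
      (integrable_finsetSum _ fun j _ => integrable_one_sub_cos ν (s j))
      fun p => ?_
    by_cases hp : p ∈ {p : ℝ × ℝ | 1 ≤ |p.1 - p.2| ∧ |p.1 - p.2| ≤ b}
    · rw [Set.indicator_of_mem hp]
      exact hs _ hp.1 hp.2
    · rw [Set.indicator_of_notMem hp]
      exact Finset.sum_nonneg fun j _ => sub_nonneg.2 (Real.cos_le_one _)
  rw [h2]
  have := mul_le_mul_of_nonneg_right hq hL
  linarith

/-- A centered variable with unit variance and bounded fourth moment is of constant order
after symmetrization, with probability bounded below. -/
theorem le_measure_symmetrization {ν : Measure ℝ} [IsProbabilityMeasure ν] {b : ℝ} (hb : 0 < b)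
    (h4 : Integrable (fun x : ℝ => x ^ 4) ν) (h2 : Integrable (fun x : ℝ => x ^ 2) ν)
    (h1 : Integrable (fun x : ℝ => x) ν)
    (hmean : ∫ x, x ∂ν = 0) (hvar : ∫ x, x ^ 2 ∂ν = 1) (hm : 32 * ∫ x, x ^ 4 ∂ν ≤ b ^ 2) :
    1 / (2 * b ^ 2) ≤ (ν.prod ν).real {p | 1 ≤ |p.1 - p.2| ∧ |p.1 - p.2| ≤ b} := by
  set E := {p : ℝ × ℝ | 1 ≤ |p.1 - p.2| ∧ |p.1 - p.2| ≤ b} with hEdef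
  have hE : MeasurableSet E := measurableSet_symm b
  have i1 : Integrable (fun p : ℝ × ℝ => p.1 ^ 2) (ν.prod ν) := h2.comp_fst ν
  have i2 : Integrable (fun p : ℝ × ℝ => p.2 ^ 2) (ν.prod ν) := h2.comp_snd ν
  have i3 : Integrable (fun p : ℝ × ℝ => p.1 * p.2) (ν.prod ν) := h1.mul_prod h1
  have i4 : Integrable (fun p : ℝ × ℝ => p.1 ^ 4) (ν.prod ν) := h4.comp_fst ν
  have i5 : Integrable (fun p : ℝ × ℝ => p.2 ^ 4) (ν.prod ν) := h4.comp_snd ν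
  have v1 : ∫ p : ℝ × ℝ, p.1 ^ 2 ∂(ν.prod ν) = 1 := by
    rw [integral_fun_fst (fun x : ℝ => x ^ 2)]; simp [hvar]
  have v2 : ∫ p : ℝ × ℝ, p.2 ^ 2 ∂(ν.prod ν) = 1 := by
    rw [integral_fun_snd (fun x : ℝ => x ^ 2)]; simp [hvar]
  have v3 : ∫ p : ℝ × ℝ, p.1 * p.2 ∂(ν.prod ν) = 0 := by
    rw [integral_prod_mul (fun x : ℝ => x) (fun x : ℝ => x)]; simp [hmean]
  have v4 : ∫ p : ℝ × ℝ, p.1 ^ 4 ∂(ν.prod ν) = ∫ x, x ^ 4 ∂ν := by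
    rw [integral_fun_fst (fun x : ℝ => x ^ 4)]; simp
  have v5 : ∫ p : ℝ × ℝ, p.2 ^ 4 ∂(ν.prod ν) = ∫ x, x ^ 4 ∂ν := by
    rw [integral_fun_snd (fun x : ℝ => x ^ 4)]; simp
  have hb2 : 0 < b ^ 2 := by positivity
  -- The square of `d = p.1 - p.2` is at most `1` if `|d| < 1`, at most `b²` on `E`, and at most `d⁴
  -- / b²` if `|d| > b`. Its mean is `2`, while the first and last terms have total mean at most
  -- `3/2`.
  have hpt : ∀ p : ℝ × ℝ, p.1 ^ 2 + p.2 ^ 2 - 2 * (p.1 * p.2)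
      ≤ 1 + E.indicator (fun _ => b ^ 2) p + 8 / b ^ 2 * (p.1 ^ 4 + p.2 ^ 4) := fun p => by
    set d := p.1 - p.2 with hd
    have e : p.1 ^ 2 + p.2 ^ 2 - 2 * (p.1 * p.2) = d ^ 2 := by rw [hd]; ring
    have h8 : d ^ 4 / b ^ 2 ≤ 8 / b ^ 2 * (p.1 ^ 4 + p.2 ^ 4) := by
      rw [div_mul_eq_mul_div]
      gcongr
      have e2 : d ^ 2 ≤ 2 * (p.1 ^ 2 + p.2 ^ 2) := by
        rw [hd]; nlinarith [sq_nonneg (p.1 + p.2)]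
      have e3 : d ^ 4 ≤ (2 * (p.1 ^ 2 + p.2 ^ 2)) ^ 2 := by
        calc d ^ 4 = (d ^ 2) ^ 2 := by ring
          _ ≤ _ := pow_le_pow_left₀ (sq_nonneg d) e2 2
      nlinarith [sq_nonneg (p.1 ^ 2 - p.2 ^ 2)]
    have h9 : 0 ≤ d ^ 4 / b ^ 2 := by positivity
    rw [e]
    by_cases hp : p ∈ E
    · rw [Set.indicator_of_mem hp]
      have : d ^ 2 ≤ b ^ 2 := by rw [← sq_abs]; exact pow_le_pow_left₀ (abs_nonneg _) hp.2 2
      linarith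
    · rw [Set.indicator_of_notMem hp]
      by_cases h : |d| < 1
      · have : d ^ 2 ≤ 1 := by rw [← sq_abs]; nlinarith [abs_nonneg d]
        linarith
      · have hbd : b < |d| := by
          by_contra hcon
          exact hp ⟨not_lt.1 h, not_lt.1 hcon⟩
        have : d ^ 2 ≤ d ^ 4 / b ^ 2 := by
          rw [le_div_iff₀ hb2]
          have : b ^ 2 ≤ d ^ 2 := by rw [← sq_abs d]; exact pow_le_pow_left₀ hb.le hbd.le 2
          calc d ^ 2 * b ^ 2 ≤ d ^ 2 * d ^ 2 := by gcongr
            _ = _ := by ring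
        linarith
  have i12 : Integrable (fun p : ℝ × ℝ => p.1 ^ 2 + p.2 ^ 2) (ν.prod ν) := i1.add i2
  have i123 : Integrable (fun p : ℝ × ℝ => p.1 ^ 2 + p.2 ^ 2 - 2 * (p.1 * p.2)) (ν.prod ν) :=
    i12.sub (i3.const_mul 2)
  have i45 : Integrable (fun p : ℝ × ℝ => p.1 ^ 4 + p.2 ^ 4) (ν.prod ν) := i4.add i5
  have iE : Integrable (E.indicator (fun _ => b ^ 2)) (ν.prod ν) := (integrable_const _).indicator hE
  have i1E : Integrable (fun p => 1 + E.indicator (fun _ => b ^ 2) p) (ν.prod ν) :=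
    (integrable_const 1).add iE
  have hI := integral_mono i123 (i1E.add (i45.const_mul (8 / b ^ 2))) hpt
  have hl : ∫ p : ℝ × ℝ, (p.1 ^ 2 + p.2 ^ 2 - 2 * (p.1 * p.2)) ∂(ν.prod ν) = 2 := by
    rw [integral_sub i12 (i3.const_mul 2), integral_add i1 i2, integral_const_mul, v1, v2, v3]
    norm_num
  have hr : ∫ p : ℝ × ℝ, (1 + E.indicator (fun _ => b ^ 2) p
      + 8 / b ^ 2 * (p.1 ^ 4 + p.2 ^ 4)) ∂(ν.prod ν)
      = 1 + (ν.prod ν).real E * b ^ 2 + 8 / b ^ 2 * (∫ x, x ^ 4 ∂ν + ∫ x, x ^ 4 ∂ν) := by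
    rw [integral_add i1E (i45.const_mul (8 / b ^ 2)), integral_add (integrable_const 1) iE,
      integral_indicator_const _ hE, integral_const_mul, integral_add i4 i5, v4, v5]
    simp
  have hI' : (2 : ℝ) ≤ 1 + (ν.prod ν).real E * b ^ 2
      + 8 / b ^ 2 * (∫ x, x ^ 4 ∂ν + ∫ x, x ^ 4 ∂ν) := by
    rw [← hl, ← hr]; exact hI
  have h5 : 8 / b ^ 2 * (∫ x, x ^ 4 ∂ν + ∫ x, x ^ 4 ∂ν) ≤ 1 / 2 := by
    rw [div_mul_eq_mul_div, div_le_iff₀ hb2]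
    linarith
  rw [div_le_iff₀ (by positivity)]
  linarith

/-- A scale on which symmetrized sub-Gaussian variables of unit variance live. -/
def symmScale (c : ℝ≥0) : ℝ := Real.sqrt (1536 * Real.exp (c / 2))

theorem symmScale_pos (c : ℝ≥0) : 0 < symmScale c := Real.sqrt_pos.2 (by positivity)

theorem IsStdSubgaussian.le_measure {Ω : Type*} [MeasurableSpace Ω] {P : Measure Ω}
    [IsProbabilityMeasure P] {X : Ω → ℝ} {c : ℝ≥0} (h : IsStdSubgaussian X c P) :
    1 / (2 * symmScale c ^ 2) ≤ ((P.map X).prod (P.map X)).real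
      {p | 1 ≤ |p.1 - p.2| ∧ |p.1 - p.2| ≤ symmScale c} := by
  have hX := h.aemeasurable
  have := Measure.isProbabilityMeasure_map hX (μ := P)
  have hmem := h.subgaussian.memLp
  have j4 : Integrable (fun ω => X ω ^ 4) P := by
    have := (hmem 4).integrable_norm_pow (by norm_num)
    simpa [Real.norm_eq_abs, Even.pow_abs (by decide : Even 4)] using this
  have j2 : Integrable (fun ω => X ω ^ 2) P := (hmem 2).integrable_sq
  have j1 : Integrable X P := memLp_one_iff_integrable.1 (by simpa using hmem 1)
  have hint : ∀ k : ℕ, ∫ x, x ^ k ∂(P.map X) = ∫ ω, X ω ^ k ∂P := fun k =>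
    integral_map hX (Continuous.aestronglyMeasurable (by fun_prop))
  have hi : ∀ k : ℕ, Integrable (fun ω => X ω ^ k) P →
      Integrable (fun x : ℝ => x ^ k) (P.map X) := fun k hk =>
    (integrable_map_measure (Continuous.aestronglyMeasurable (by fun_prop)) hX).2 hk
  refine le_measure_symmetrization (symmScale_pos c) (hi 4 j4) (hi 2 j2)
    (by simpa using hi 1 (by simpa using j1))
    (by simpa [h.mean_eq_zero] using hint 1) ?_ ?_
  · rw [hint, ← h.variance_eq_one, variance_of_integral_eq_zero hX h.mean_eq_zero]
  · rw [hint, symmScale, Real.sq_sqrt (by positivity)]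
    have e1 := h.subgaussian.integrable_exp_mul 1
    have e2 := h.subgaussian.integrable_exp_mul (-1)
    have m1 := h.subgaussian.mgf_le 1
    have m2 := h.subgaussian.mgf_le (-1)
    -- From `x⁴ / 4! ≤ e^|x|` the fourth moment is at most `48 e^(c/2)`; `1536 = 32 * 48`.
    have hle : ∫ ω, X ω ^ 4 ∂P
        ≤ ∫ ω, 24 * (Real.exp (1 * X ω) + Real.exp (-1 * X ω)) ∂P := by
      refine integral_mono j4 ((e1.add e2).const_mul 24) fun ω => ?_
      have h1 := Real.pow_div_factorial_le_exp |X ω| (abs_nonneg _) 4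
      rw [Even.pow_abs (by decide : Even 4)] at h1
      have h2 : Real.exp |X ω| ≤ Real.exp (1 * X ω) + Real.exp (-1 * X ω) := by
        rw [one_mul, neg_one_mul]
        exact Real.exp_abs_le (X ω)
      have h3 : ((4 : ℕ).factorial : ℝ) = 24 := by norm_num [Nat.factorial]
      rw [h3] at h1
      dsimp only
      linarith
    rw [integral_const_mul, integral_add e1 e2] at hle
    simp only [mgf, one_pow, mul_one, even_two, Even.neg_pow] at m1 m2
    simp only [one_mul] at m1 m2 hle
    linarith

/-! ### Gaussian integrals and Esseen's inequality. -/

theorem integrable_exp_neg_mul_norm_sq {β : ℝ} (hβ : 0 < β) :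
    Integrable (fun u : ℂ => Real.exp (-β * ‖u‖ ^ 2)) := by
  have := (GaussianFourier.integrable_cexp_neg_mul_sq_norm_add (V := ℂ) (b := β)
    (by simpa using hβ) 0 0).norm
  refine this.congr (Filter.Eventually.of_forall fun u => ?_)
  simp only [zero_mul, add_zero]
  rw [Complex.norm_exp]
  norm_cast

theorem integral_exp_neg_mul_norm_sq {β : ℝ} (hβ : 0 < β) :
    ∫ u : ℂ, Real.exp (-β * ‖u‖ ^ 2) = Real.pi / β := by
  rw [GaussianFourier.integral_rexp_neg_mul_sq_norm hβ, Complex.finrank_real_complex]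
  norm_num

theorem exp_neg_eq_integral {δ : ℝ} (hδ : 0 < δ) (w : ℂ) :
    (Real.exp (-(‖w‖ ^ 2 / (2 * δ ^ 2))) : ℂ) = (δ ^ 2 / (2 * Real.pi) : ℝ) *
      ∫ u : ℂ, Complex.exp (-((δ ^ 2 / 2 : ℝ) : ℂ) * ‖u‖ ^ 2
        + Complex.I * (inner ℝ w u : ℝ)) := by
  rw [GaussianFourier.integral_cexp_neg_mul_sq_norm_add (V := ℂ)
    (by rw [Complex.ofReal_re]; positivity), Complex.finrank_real_complex]
  have hδ' : (δ : ℂ) ≠ 0 := by exact_mod_cast hδ.ne'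
  have hpi : (Real.pi : ℂ) ≠ 0 := by exact_mod_cast Real.pi_pos.ne'
  rw [Complex.I_sq, show (((2 : ℕ) : ℂ) / 2) = 1 by norm_num, Complex.cpow_one, ← mul_assoc]
  have h1 : ((δ ^ 2 / (2 * Real.pi) : ℝ) : ℂ) * (Real.pi / ((δ ^ 2 / 2 : ℝ) : ℂ)) = 1 := by
    push_cast; field_simp
  rw [h1, one_mul]
  push_cast
  congr 1
  field_simp
  ring

/-- Esseen's inequality in the plane, with a Gaussian weight. -/
theorem measure_norm_le_le_integral_charFun (μ : Measure ℂ) [IsProbabilityMeasure μ] {δ : ℝ}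
    (hδ : 0 < δ) :
    μ.real {w | ‖w‖ ≤ δ} ≤ Real.exp (1 / 2) * (δ ^ 2 / (2 * Real.pi)) *
      ∫ u : ℂ, Real.exp (-(δ ^ 2 / 2) * ‖u‖ ^ 2) * ‖charFun μ u‖ := by
  have hβ : 0 < δ ^ 2 / 2 := by positivity
  set F : ℂ → ℂ → ℂ := fun w u => Complex.exp (-((δ ^ 2 / 2 : ℝ) : ℂ) * ‖u‖ ^ 2
        + Complex.I * (inner ℝ w u : ℝ)) with hF
  have hFnorm : ∀ w u, ‖F w u‖ = Real.exp (-(δ ^ 2 / 2) * ‖u‖ ^ 2) := fun w u => by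
    rw [hF, Complex.norm_exp]
    congr 1
    simp [← Complex.ofReal_pow]
  have hFint : Integrable (Function.uncurry F) (μ.prod volume) := by
    refine ((integrable_exp_neg_mul_norm_sq hβ).comp_snd μ).mono'
      (Continuous.aestronglyMeasurable ?_)
      (Filter.Eventually.of_forall fun p => (hFnorm p.1 p.2).le)
    rw [hF]
    simp only [Function.uncurry_def]
    fun_prop
  have h1 : (∫ w, Real.exp (-(‖w‖ ^ 2 / (2 * δ ^ 2))) ∂μ : ℝ)
      ≤ δ ^ 2 / (2 * Real.pi) *
        ∫ u : ℂ, Real.exp (-(δ ^ 2 / 2) * ‖u‖ ^ 2) * ‖charFun μ u‖ := by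
    have e1 : ((∫ w, Real.exp (-(‖w‖ ^ 2 / (2 * δ ^ 2))) ∂μ : ℝ) : ℂ)
        = (δ ^ 2 / (2 * Real.pi) : ℝ) * ∫ u : ℂ, ∫ w, F w u ∂μ := by
      rw [← integral_complex_ofReal, ← integral_integral_swap hFint, ← integral_const_mul]
      exact integral_congr_ae (Filter.Eventually.of_forall fun w => exp_neg_eq_integral hδ w)
    have e2 : ∀ u, ‖∫ w, F w u ∂μ‖
        = Real.exp (-(δ ^ 2 / 2) * ‖u‖ ^ 2) * ‖charFun μ u‖ := fun u => by
      have : ∀ w, F w u = Complex.exp (-((δ ^ 2 / 2 : ℝ) : ℂ) * ‖u‖ ^ 2) *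
          Complex.exp ((inner ℝ w u : ℝ) * Complex.I) := fun w => by
        rw [← Complex.exp_add, mul_comm _ Complex.I]
      simp_rw [this]
      rw [integral_const_mul, norm_mul, ← charFun_apply, Complex.norm_exp]
      congr 2
      simp [← Complex.ofReal_pow]
    have hnn : 0 ≤ ∫ w, Real.exp (-(‖w‖ ^ 2 / (2 * δ ^ 2))) ∂μ :=
      integral_nonneg fun _ => (Real.exp_pos _).le
    have e3 := congrArg norm e1
    rw [Complex.norm_real, Real.norm_of_nonneg hnn, norm_mul, Complex.norm_real,
      Real.norm_of_nonneg (by positivity)] at e3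
    rw [e3]
    gcongr
    refine (norm_integral_le_integral_norm _).trans (le_of_eq ?_)
    simp_rw [e2]
  have hS : MeasurableSet {w : ℂ | ‖w‖ ≤ δ} :=
    (isClosed_le continuous_norm continuous_const).measurableSet
  have h2 : μ.real {w | ‖w‖ ≤ δ}
      -- The Gaussian is at least `e^(-1/2)` on the disc of radius `δ`.
      ≤ ∫ w, Real.exp (1 / 2) * Real.exp (-(‖w‖ ^ 2 / (2 * δ ^ 2))) ∂μ := by
    rw [← integral_indicator_one hS]
    refine integral_mono ((integrable_const 1).indicator hS) ?_ fun w => ?_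
    · refine (Integrable.of_bound (Continuous.aestronglyMeasurable (by fun_prop)) 1 ?_).const_mul _
      refine Filter.Eventually.of_forall fun w => ?_
      rw [Real.norm_of_nonneg (Real.exp_pos _).le, Real.exp_le_one_iff]
      exact neg_nonpos.2 (by positivity)
    · by_cases hw : w ∈ {w : ℂ | ‖w‖ ≤ δ}
      · rw [Set.indicator_of_mem hw, ← Real.exp_add, Pi.one_apply]
        apply Real.one_le_exp
        have : ‖w‖ ^ 2 ≤ δ ^ 2 := pow_le_pow_left₀ (norm_nonneg _) hw 2
        have : ‖w‖ ^ 2 / (2 * δ ^ 2) ≤ 1 / 2 := by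
          rw [div_le_iff₀ (by positivity)]; linarith
        linarith
      · rw [Set.indicator_of_notMem hw]
        positivity
  rw [integral_const_mul] at h2
  refine h2.trans ?_
  rw [mul_assoc]
  gcongr

/-! ### Characteristic functions of the admissible coefficients. -/

open scoped ComplexConjugate

theorem charFun_map_complex {Ω : Type*} [MeasurableSpace Ω] {P : Measure Ω} {Z : Ω → ℂ}
    (hZ : AEMeasurable Z P) {S : Ω → ℝ} (hS : AEMeasurable S P) (u : ℂ)
    (h : ∀ ω, (Z ω * conj u).re = S ω) :
    charFun (P.map Z) u = charFun (P.map S) 1 := by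
  rw [charFun_apply, charFun_apply, integral_map hZ
    (Continuous.aestronglyMeasurable (by fun_prop)), integral_map hS
    (Continuous.aestronglyMeasurable (by fun_prop))]
  congr 1
  ext ω
  have h1 : (inner ℝ (Z ω) u : ℝ) = S ω := by
    rw [← h ω, real_inner_comm, Complex.inner]
  have h2 : (inner ℝ (S ω) (1 : ℝ) : ℝ) = S ω := by simp
  rw [h1, h2]

/-- The characteristic function of a rotated and scaled admissible coefficient is dominated by
that of a real standard sub-Gaussian variable. -/
theorem IsCoefficient.exists_charFun_le {Ω : Type*} [MeasurableSpace Ω] {P : Measure Ω}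
    [IsProbabilityMeasure P] {ξ : Ω → ℂ} {c : ℝ≥0} (h : IsCoefficient ξ c P) :
    ∃ (lam : ℝ) (X : Ω → ℝ), 1 / 2 ≤ lam ∧ lam ≤ 1 ∧ IsStdSubgaussian X c P ∧
      ∀ d u : ℂ, ‖charFun (P.map fun ω => d * ξ ω) u‖
        ≤ ‖charFun (P.map X) (lam * (d * conj u).re)‖ := by
  rcases h with ⟨X, hX, hξ⟩ | ⟨X, Y, hX, hind, hid, hξ⟩
  · refine ⟨1, X, by norm_num, le_rfl, hX, fun d u => le_of_eq ?_⟩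
    have hm := hX.aemeasurable
    rw [charFun_map_complex (S := fun ω => (1 * (d * conj u).re) * X ω)
      ((Complex.measurable_ofReal.comp_aemeasurable hm).congr
        (Filter.Eventually.of_forall fun ω => (hξ ω).symm) |>.const_mul d) (hm.const_mul _) u
      fun ω => ?_, charFun_map_mul_comp hm, mul_one]
    rw [hξ, mul_right_comm, Complex.re_mul_ofReal]
    ring
  · have hm := hX.aemeasurable
    have hmY := hid.aemeasurable_snd
    have h2 : (0 : ℝ) < Real.sqrt 2 := by positivity
    have h2sq := Real.sq_sqrt (show (0 : ℝ) ≤ 2 by norm_num)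
    refine ⟨1 / Real.sqrt 2, X, ?_, ?_, hX, fun d u => ?_⟩
    · rw [div_le_div_iff₀ (by norm_num) h2]
      nlinarith
    · rw [div_le_one h2]
      nlinarith
    · have hmeas : AEMeasurable (fun ω => d * ξ ω) P := by
        have : AEMeasurable (fun ω => d * (((X ω : ℂ) + Complex.I * (Y ω : ℂ)) /
            (Real.sqrt 2 : ℂ))) P :=
          (((Complex.measurable_ofReal.comp_aemeasurable hm).add
            ((Complex.measurable_ofReal.comp_aemeasurable hmY).const_mul _)).div_const _).const_mul _
        simpa only [hξ] using this
      rw [charFun_map_complex (S := fun ω => (1 / Real.sqrt 2 * (d * conj u).re) * X ω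
          + (1 / Real.sqrt 2 * (Complex.I * (d * conj u)).re) * Y ω) hmeas
          ((hm.const_mul _).add (hmY.const_mul _)) u fun ω => ?_]
      · rw [IndepFun.charFun_map_fun_add_eq_mul (hm.const_mul _) (hmY.const_mul _)
          (hind.comp (measurable_const_mul _) (measurable_const_mul _)), Pi.mul_apply,
          charFun_map_mul_comp hm, mul_one, norm_mul]
        have := Measure.isProbabilityMeasure_map (hmY.const_mul
          (1 / Real.sqrt 2 * (Complex.I * (d * conj u)).re)) (μ := P)
        -- The factor of the imaginary part `Y` is simply discarded.
        exact mul_le_of_le_one_right (norm_nonneg _) (norm_charFun_le_one _)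
      · rw [hξ]
        have : d * (((X ω : ℂ) + Complex.I * (Y ω : ℂ)) / (Real.sqrt 2 : ℂ)) * conj u
            = (d * conj u) * ((1 / Real.sqrt 2 * X ω : ℝ) : ℂ)
              + (Complex.I * (d * conj u)) * ((1 / Real.sqrt 2 * Y ω : ℝ) : ℂ) := by
          push_cast; ring
        rw [this, Complex.add_re, Complex.re_mul_ofReal, Complex.re_mul_ofReal]
        ring

/-! ### Decay at small and intermediate frequencies. -/

theorem sq_div_five_le_one_sub_cos {x : ℝ} (hx : |x| ≤ Real.pi) :
    x ^ 2 / 5 ≤ 1 - Real.cos x := by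
  have h := Real.cos_le_one_sub_mul_cos_sq hx
  have hpi : Real.pi ^ 2 ≤ 10 := by nlinarith [Real.pi_lt_d2, Real.pi_pos]
  have h2 : 1 / 5 ≤ 2 / Real.pi ^ 2 := by
    rw [div_le_div_iff₀ (by norm_num) (by positivity)]
    linarith
  nlinarith [mul_le_mul_of_nonneg_right h2 (sq_nonneg x)]

theorem eight_mul_distInt_sq_le (x : ℝ) :
    8 * distInt x ^ 2 ≤ 1 - Real.cos (2 * Real.pi * x) := by
  have hpi := Real.pi_pos
  have h1 : Real.cos (2 * Real.pi * x) = Real.cos (2 * Real.pi * (x - round x)) := by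
    rw [mul_sub, mul_comm (2 * Real.pi) (round x : ℝ), Real.cos_sub_int_mul_two_pi]
  have h2 : |2 * Real.pi * (x - round x)| ≤ Real.pi := by
    rw [abs_mul, abs_of_pos (by positivity)]
    nlinarith [abs_sub_round x]
  have h3 := Real.cos_le_one_sub_mul_cos_sq h2
  have h4 : 2 / Real.pi ^ 2 * (2 * Real.pi * (x - round x)) ^ 2 = 8 * (x - round x) ^ 2 := by
    field_simp; ring
  rw [h1, distInt, sq_abs]
  linarith

theorem osc_mul_ofReal (n : ℕ) (a b θ : ℝ) (z : ℂ) (x : ℝ) (j : ℤ) :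
    osc n a b θ (z * x) j = osc n a b θ z j * x := by
  rw [osc, osc, mul_right_comm, Complex.re_mul_ofReal]

theorem abs_osc_le {n : ℕ} {a b : ℝ} (hn : 1 ≤ n) (hab : IsAmplitude a b) (θ : ℝ) (z : ℂ) {j : ℤ}
    (hj : j ∈ Finset.Icc (-(n : ℤ)) n) : |osc n a b θ z j| ≤ ‖z‖ := by
  rw [Finset.mem_Icc] at hj
  have hn0 : (0 : ℝ) < n := by exact_mod_cast hn
  refine (Complex.abs_re_le_norm _).trans ?_
  rw [norm_mul, norm_mul, ← Complex.ofReal_intCast, norm_exp_I_mul, mul_one, Complex.norm_real,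
    Real.norm_eq_abs]
  refine mul_le_of_le_one_right (norm_nonneg _) ?_
  rcases hab with ⟨rfl, rfl⟩ | ⟨rfl, rfl⟩
  · simp
  · have h1 : (-(n : ℝ)) ≤ j := by exact_mod_cast hj.1
    have h2 : (j : ℝ) ≤ n := by exact_mod_cast hj.2
    rw [zero_add, one_mul, abs_div, abs_of_pos hn0, div_le_one hn0, abs_le]
    exact ⟨h1, h2⟩

/-- No phase leaves `[-π, π]`, so `1 - cos` is comparable to the square and the energy bound
applies. With `ρ² n ≥ 1/12` the constants combine as `30720 = 2 * 12 * 5 * 256`. -/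
theorem prod_norm_charFun_osc_le_of_norm_le {ν : Measure ℝ} [IsProbabilityMeasure ν] {n : ℕ}
    {a b θ B q ρ : ℝ} {z : ℂ} (hn : 1 ≤ n) (hab : IsAmplitude a b)
    (hρ : 0 ≤ ρ) (hρn : 1 / 12 ≤ ρ ^ 2 * n)
    (hq : q ≤ (ν.prod ν).real {p | 1 ≤ |p.1 - p.2| ∧ |p.1 - p.2| ≤ B})
    (hosc : n * ‖z‖ ^ 2 / 256 ≤ ∑ j ∈ Finset.Icc (-(n : ℤ)) n, osc n a b θ z j ^ 2)
    (hz : ρ * ‖z‖ * B ≤ Real.pi) :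
    ∏ j ∈ Finset.Icc (-(n : ℤ)) n, ‖charFun ν (ρ * osc n a b θ z j)‖
      ≤ Real.exp (-(q / 30720) * ‖z‖ ^ 2) := by
  refine (prod_norm_charFun_le ν _ (fun j => ρ * osc n a b θ z j) (L := ‖z‖ ^ 2 / 15360)
    (by positivity) hq fun y hy1 hyB => ?_).trans ?_
  · have h1 : ∀ j ∈ Finset.Icc (-(n : ℤ)) n,
        ρ ^ 2 / 5 * osc n a b θ z j ^ 2 ≤ 1 - Real.cos (ρ * osc n a b θ z j * y) := fun j hj => by
      have h2 : |ρ * osc n a b θ z j * y| ≤ Real.pi := by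
        rw [abs_mul, abs_mul, abs_of_nonneg hρ]
        refine le_trans ?_ hz
        gcongr
        exact abs_osc_le hn hab θ z hj
      refine le_trans ?_ (sq_div_five_le_one_sub_cos h2)
      have h3 : 1 ≤ y ^ 2 := by rw [← sq_abs]; nlinarith
      rw [mul_pow, mul_pow]
      have : ρ ^ 2 * osc n a b θ z j ^ 2 * 1 ≤ ρ ^ 2 * osc n a b θ z j ^ 2 * y ^ 2 := by gcongr
      linarith
    refine le_trans ?_ (Finset.sum_le_sum h1)
    rw [← Finset.mul_sum]
    calc ‖z‖ ^ 2 / 15360 = (1 / 12) * (‖z‖ ^ 2 / 1280) := by ring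
      _ ≤ ρ ^ 2 * n * (‖z‖ ^ 2 / 1280) := by gcongr
      _ = ρ ^ 2 / 5 * (n * ‖z‖ ^ 2 / 256) := by ring
      _ ≤ _ := by gcongr
  · rw [Real.exp_le_exp]
    linarith

/-- The factor `ρ y / 2π` is absorbed into `z`, turning phases into `2π` times an oscillating
sequence. The threshold `π`, complementary to that of `prod_norm_charFun_osc_le_of_norm_le`, gives
amplitude at least `1 / (2 * B)`. -/
theorem prod_norm_charFun_osc_le_of_le_norm {ν : Measure ℝ} [IsProbabilityMeasure ν] {n : ℕ}
    {a b θ B q ρ E T : ℝ} {z : ℂ} (hB : 0 < B)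
    (hρ : 0 ≤ ρ) (hρ1 : ρ ≤ 1) (hT : 0 ≤ T)
    (hq : q ≤ (ν.prod ν).real {p | 1 ≤ |p.1 - p.2| ∧ |p.1 - p.2| ≤ B})
    (hosc : ∀ w : ℂ, 1 / (2 * B) ≤ ‖w‖ → ‖w‖ ≤ E →
      T ≤ ∑ j ∈ Finset.Icc (-(n : ℤ)) n, distInt (osc n a b θ w j) ^ 2)
    (hz : Real.pi ≤ ρ * ‖z‖ * B) (hzE : ‖z‖ * B ≤ E) :
    ∏ j ∈ Finset.Icc (-(n : ℤ)) n, ‖charFun ν (ρ * osc n a b θ z j)‖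
      ≤ Real.exp (-(4 * q * T)) := by
  have hpi := Real.pi_pos
  refine (prod_norm_charFun_le ν _ (fun j => ρ * osc n a b θ z j) (L := 8 * T)
    (by positivity) hq fun y hy1 hyB => ?_).trans ?_
  · set w : ℂ := z * ((ρ * y / (2 * Real.pi) : ℝ) : ℂ) with hw
    have hwn : ‖w‖ = ρ * ‖z‖ * |y| / (2 * Real.pi) := by
      rw [hw, norm_mul, Complex.norm_real, Real.norm_eq_abs, abs_div, abs_mul, abs_of_nonneg hρ,
        abs_of_pos (by positivity : 0 < 2 * Real.pi)]
      ring
    have hw1 : 1 / (2 * B) ≤ ‖w‖ := by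
      rw [hwn, div_le_div_iff₀ (by positivity) (by positivity)]
      have : ρ * ‖z‖ * 1 * (2 * B) ≤ ρ * ‖z‖ * |y| * (2 * B) := by gcongr
      linarith
    have hw2 : ‖w‖ ≤ E := by
      refine le_trans ?_ hzE
      rw [hwn, div_le_iff₀ (by positivity)]
      have h1 : ρ * ‖z‖ * |y| ≤ 1 * ‖z‖ * B := by gcongr
      have h2 : 0 ≤ ‖z‖ * B := by positivity
      nlinarith [Real.pi_gt_three]
    refine (mul_le_mul_of_nonneg_left (hosc w hw1 hw2) (by norm_num)).trans ?_
    rw [Finset.mul_sum]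
    refine Finset.sum_le_sum fun j _ => (eight_mul_distInt_sq_le _).trans (le_of_eq ?_)
    rw [hw, osc_mul_ofReal]
    congr 2
    field_simp
  · rw [Real.exp_le_exp]
    linarith

open Filter in
theorem eventually_rpow_mul_exp_neg_le_one (s : ℝ) {σ γ : ℝ} (hσ : 0 < σ) (hγ : 0 < γ) :
    ∀ᶠ n : ℕ in atTop, (n : ℝ) ^ s * Real.exp (-(γ * (n : ℝ) ^ σ)) ≤ 1 := by
  have h1 : Tendsto (fun n : ℕ => (n : ℝ) ^ σ) atTop atTop :=
    (tendsto_rpow_atTop hσ).comp tendsto_natCast_atTop_atTop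
  have h2 := (tendsto_rpow_mul_exp_neg_mul_atTop_nhds_zero (s / σ) γ hγ).comp h1
  filter_upwards [h2.eventually_lt_const zero_lt_one] with n hn
  refine le_of_eq_of_le ?_ hn.le
  simp only [Function.comp_apply]
  rw [← Real.rpow_mul (Nat.cast_nonneg n), mul_div_cancel₀ _ hσ.ne', neg_mul]

/-! ### Assembly of the small ball estimate. -/

/-- The coefficient of the `j`-th random variable in a rescaled trigonometric polynomial, or in
its derivative. -/
def coef (n : ℕ) (a b : ℝ) (τ : ℂ) (θ : ℝ) (j : ℤ) : ℂ :=
  τ * ((1 / Real.sqrt (2 * n + 1) : ℝ) : ℂ) *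
    (((a + b * (j / n) : ℝ) : ℂ) * Complex.exp (Complex.I * (j * θ)))

theorem coef_mul_conj_re (n : ℕ) (a b : ℝ) (τ : ℂ) (θ : ℝ) (j : ℤ) (u : ℂ) :
    (coef n a b τ θ j * conj u).re
      = 1 / Real.sqrt (2 * n + 1) * osc n a b θ (τ * conj u) j := by
  rw [osc, ← Complex.re_ofReal_mul, coef]
  congr 1
  ring

theorem norm_charFun_map_sum_le {Ω : Type*} [MeasurableSpace Ω] {P : Measure Ω}
    {ξ : ℤ → Ω → ℂ} (hind : iIndepFun ξ P) (hid : ∀ j, IdentDistrib (ξ j) (ξ 0) P P)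
    {X : Ω → ℝ} {lam : ℝ}
    (hX : ∀ d u : ℂ, ‖charFun (P.map fun ω => d * ξ 0 ω) u‖
        ≤ ‖charFun (P.map X) (lam * (d * conj u).re)‖)
    (S : Finset ℤ) (d : ℤ → ℂ) (u : ℂ) :
    ‖charFun (P.map fun ω => ∑ j ∈ S, d j * ξ j ω) u‖
      ≤ ∏ j ∈ S, ‖charFun (P.map X) (lam * (d j * conj u).re)‖ := by
  have hind' : iIndepFun (fun j ω => d j * ξ j ω) P :=
    hind.comp (fun j z => d j * z) fun j => measurable_const_mul (d j)
  rw [iIndepFun.charFun_map_fun_finsetSum_eq_prod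
    (fun j _ => (hid j).aemeasurable_fst.const_mul (d j)) (hind'.restrict _),
    Finset.prod_apply, norm_prod]
  refine Finset.prod_le_prod (fun j _ => norm_nonneg _) fun j _ => ?_
  have h : P.map (fun ω => d j * ξ j ω) = P.map (fun ω => d j * ξ 0 ω) :=
    ((hid j).comp (measurable_const_mul (d j))).map_eq
  rw [h]
  exact hX (d j) u

/-- Pointwise Gaussian domination of the weighted characteristic function, the three terms
corresponding to small, intermediate and large frequencies. -/
theorem exp_mul_norm_charFun_le {Ω : Type*} [MeasurableSpace Ω] {P : Measure Ω}
    [IsProbabilityMeasure P] {ξ : ℤ → Ω → ℂ} (hind : iIndepFun ξ P)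
    (hid : ∀ j, IdentDistrib (ξ j) (ξ 0) P P) {c : ℝ≥0} (hξ : IsCoefficient (ξ 0) c P)
    {n : ℕ} {K T a b θ δ : ℝ} {τ : ℂ} (hn : 1 ≤ n) (hBn : symmScale c ≤ n)
    (hab : IsAmplitude a b) (hτ : ‖τ‖ = 1) (hT : 0 ≤ T) (hδ : (n : ℝ) ^ (-K) ≤ δ)
    (hosc : ∀ z, n * ‖z‖ ^ 2 / 256 ≤ ∑ j ∈ Finset.Icc (-(n : ℤ)) n, osc n a b θ z j ^ 2)
    (hdist : ∀ z, 1 / (2 * symmScale c) ≤ ‖z‖ → ‖z‖ ≤ (n : ℝ) ^ (K + 2) →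
      T ≤ ∑ j ∈ Finset.Icc (-(n : ℤ)) n, distInt (osc n a b θ z j) ^ 2) (u : ℂ) :
    Real.exp (-(δ ^ 2 / 2) * ‖u‖ ^ 2) *
      ‖charFun (P.map fun ω => ∑ j ∈ Finset.Icc (-(n : ℤ)) n, coef n a b τ θ j * ξ j ω) u‖
      ≤ Real.exp (-(1 / (2 * symmScale c ^ 2) / 30720) * ‖u‖ ^ 2)
        + Real.exp (-(4 * (1 / (2 * symmScale c ^ 2)) * T)) * Real.exp (-(δ ^ 2 / 2) * ‖u‖ ^ 2)
        + Real.exp (-(1 / 4 * (n : ℝ) ^ (2 : ℝ))) * Real.exp (-(δ ^ 2 / 4) * ‖u‖ ^ 2) := by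
  obtain ⟨lam, X, hlam, hlam1, hX, hle⟩ := hξ.exists_charFun_le
  have hB := symmScale_pos c
  set B := symmScale c
  have hν := Measure.isProbabilityMeasure_map hX.aemeasurable (μ := P)
  have hn0 : (0 : ℝ) < n := by exact_mod_cast hn
  have hn1 : (1 : ℝ) ≤ n := by exact_mod_cast hn
  have hs : 1 ≤ Real.sqrt (2 * n + 1) := Real.one_le_sqrt.2 (by linarith)
  have hssq : Real.sqrt (2 * n + 1) ^ 2 = 2 * n + 1 := Real.sq_sqrt (by positivity)
  set ρ := lam * (1 / Real.sqrt (2 * n + 1)) with hρ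
  have hρ0 : 0 ≤ ρ := by positivity
  have hρ1 : ρ ≤ 1 := by
    have : 1 / Real.sqrt (2 * n + 1) ≤ 1 := by
      rw [div_le_one (by linarith)]; exact hs
    exact mul_le_one₀ hlam1 (by positivity) this
  have hρn : 1 / 12 ≤ ρ ^ 2 * n := by
    have h4 : 1 / 4 ≤ lam ^ 2 := by nlinarith
    have h3 : 1 / 3 ≤ (n : ℝ) / (2 * n + 1) := by
      rw [div_le_div_iff₀ (by norm_num) (by positivity)]; linarith
    rw [hρ, mul_pow, div_pow, hssq, one_pow]
    calc (1 : ℝ) / 12 = 1 / 4 * (1 / 3) := by norm_num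
      _ ≤ lam ^ 2 * (n / (2 * n + 1)) := by gcongr
      _ = _ := by ring
  set z : ℂ := τ * conj u with hz
  have hzn : ‖z‖ = ‖u‖ := by rw [hz, norm_mul, hτ, one_mul, RCLike.norm_conj]
  have hφ : ‖charFun (P.map fun ω => ∑ j ∈ Finset.Icc (-(n : ℤ)) n,
      coef n a b τ θ j * ξ j ω) u‖
      ≤ ∏ j ∈ Finset.Icc (-(n : ℤ)) n, ‖charFun (P.map X) (ρ * osc n a b θ z j)‖ := by
    refine (norm_charFun_map_sum_le hind hid hle _ _ u).trans (le_of_eq ?_)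
    refine Finset.prod_congr rfl fun j _ => ?_
    rw [coef_mul_conj_re, hρ, mul_assoc]
  have hw1 : Real.exp (-(δ ^ 2 / 2) * ‖u‖ ^ 2) ≤ 1 := by
    rw [Real.exp_le_one_iff]
    nlinarith [sq_nonneg δ, sq_nonneg ‖u‖, mul_nonneg (sq_nonneg δ) (sq_nonneg ‖u‖)]
  by_cases h1 : ρ * ‖z‖ * B ≤ Real.pi
  · have := prod_norm_charFun_osc_le_of_norm_le hn hab hρ0 hρn hX.le_measure (hosc z) h1
    rw [hzn] at this
    have h2 := mul_le_mul hw1 (hφ.trans this) (norm_nonneg _) zero_le_one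
    rw [one_mul] at h2
    refine h2.trans ?_
    have p1 := Real.exp_pos (-(4 * (1 / (2 * B ^ 2)) * T))
    have p2 := Real.exp_pos (-(δ ^ 2 / 2) * ‖u‖ ^ 2)
    have p3 := Real.exp_pos (-(1 / 4 * (n : ℝ) ^ (2 : ℝ)))
    have p4 := Real.exp_pos (-(δ ^ 2 / 4) * ‖u‖ ^ 2)
    nlinarith [mul_pos p1 p2, mul_pos p3 p4]
  by_cases h2 : ‖u‖ ≤ (n : ℝ) ^ (K + 1)
  · have hE : ‖z‖ * B ≤ (n : ℝ) ^ (K + 2) := by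
      rw [hzn, show K + 2 = K + 1 + 1 by ring, Real.rpow_add hn0 (K + 1) 1, Real.rpow_one]
      gcongr
    have := prod_norm_charFun_osc_le_of_le_norm hB hρ0 hρ1 hT hX.le_measure hdist
      (not_le.1 h1).le hE
    have h3 := mul_le_mul_of_nonneg_left (hφ.trans this)
      (Real.exp_pos (-(δ ^ 2 / 2) * ‖u‖ ^ 2)).le
    rw [mul_comm (Real.exp (-(δ ^ 2 / 2) * ‖u‖ ^ 2))
      (Real.exp (-(4 * (1 / (2 * B ^ 2)) * T)))] at h3
    refine h3.trans ?_
    have p1 := Real.exp_pos (-(1 / (2 * B ^ 2) / 30720) * ‖u‖ ^ 2)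
    have p3 := Real.exp_pos (-(1 / 4 * (n : ℝ) ^ (2 : ℝ)))
    have p4 := Real.exp_pos (-(δ ^ 2 / 4) * ‖u‖ ^ 2)
    nlinarith [mul_pos p3 p4]
  · have hnu : (n : ℝ) ≤ δ * ‖u‖ := by
      calc (n : ℝ) = (n : ℝ) ^ (-K) * (n : ℝ) ^ (K + 1) := by
            rw [← Real.rpow_add hn0, neg_add_cancel_left, Real.rpow_one]
        _ ≤ δ * ‖u‖ := by
            gcongr
            · exact (Real.rpow_nonneg hn0.le _).trans hδ
            · exact (not_le.1 h2).le
    have hsq : (n : ℝ) ^ 2 ≤ δ ^ 2 * ‖u‖ ^ 2 := by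
      rw [← mul_pow]; exact pow_le_pow_left₀ hn0.le hnu 2
    have hprod : ∏ j ∈ Finset.Icc (-(n : ℤ)) n, ‖charFun (P.map X) (ρ * osc n a b θ z j)‖ ≤ 1 :=
      Finset.prod_le_one (fun _ _ => norm_nonneg _) fun _ _ => norm_charFun_le_one _
    have h3 := mul_le_mul_of_nonneg_left (hφ.trans hprod)
      (Real.exp_pos (-(δ ^ 2 / 2) * ‖u‖ ^ 2)).le
    rw [mul_one] at h3
    -- Half of the exponent pays for `exp (-n² / 4)`; the other half keeps the bound integrable in
    -- `u`.
    have h4 : Real.exp (-(δ ^ 2 / 2) * ‖u‖ ^ 2)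
        ≤ Real.exp (-(1 / 4 * (n : ℝ) ^ (2 : ℝ))) * Real.exp (-(δ ^ 2 / 4) * ‖u‖ ^ 2) := by
      rw [← Real.exp_add, Real.exp_le_exp, Real.rpow_two]
      linarith
    have p1 := Real.exp_pos (-(1 / (2 * B ^ 2) / 30720) * ‖u‖ ^ 2)
    have p2 := mul_pos (Real.exp_pos (-(4 * (1 / (2 * B ^ 2)) * T)))
      (Real.exp_pos (-(δ ^ 2 / 2) * ‖u‖ ^ 2))
    linarith

/-- Integrating a weight of width `1 / δ` over the plane costs `δ⁻²`, which the prefactors `e₁, e₂ ≤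
δ²` compensate. -/
theorem integral_le_of_gaussian_bound {g : ℂ → ℝ} {β δ e₁ e₂ : ℝ} (hβ : 0 < β) (hδ : 0 < δ)
    (h1 : e₁ ≤ δ ^ 2) (h2 : e₂ ≤ δ ^ 2) (hg0 : ∀ u, 0 ≤ g u)
    (hg : ∀ u, g u ≤ Real.exp (-β * ‖u‖ ^ 2) + e₁ * Real.exp (-(δ ^ 2 / 2) * ‖u‖ ^ 2)
      + e₂ * Real.exp (-(δ ^ 2 / 4) * ‖u‖ ^ 2)) :
    ∫ u, g u ≤ Real.pi / β + 6 * Real.pi := by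
  have hpi := Real.pi_pos
  have i1 := integrable_exp_neg_mul_norm_sq hβ
  have i2 := (integrable_exp_neg_mul_norm_sq (show 0 < δ ^ 2 / 2 by positivity)).const_mul e₁
  have i3 := (integrable_exp_neg_mul_norm_sq (show 0 < δ ^ 2 / 4 by positivity)).const_mul e₂
  have i12 : Integrable fun u : ℂ => Real.exp (-β * ‖u‖ ^ 2)
      + e₁ * Real.exp (-(δ ^ 2 / 2) * ‖u‖ ^ 2) := i1.add i2
  refine (integral_mono_of_nonneg (Filter.Eventually.of_forall hg0) (i12.add i3)
    (Filter.Eventually.of_forall hg)).trans ?_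
  rw [integral_add' i12 i3, integral_add i1 i2, integral_const_mul, integral_const_mul,
    integral_exp_neg_mul_norm_sq hβ, integral_exp_neg_mul_norm_sq (by positivity),
    integral_exp_neg_mul_norm_sq (by positivity)]
  have e1 : e₁ * (Real.pi / (δ ^ 2 / 2)) ≤ 2 * Real.pi := by
    calc e₁ * (Real.pi / (δ ^ 2 / 2)) ≤ δ ^ 2 * (Real.pi / (δ ^ 2 / 2)) := by gcongr
      _ = 2 * Real.pi := by field_simp
  have e2 : e₂ * (Real.pi / (δ ^ 2 / 4)) ≤ 4 * Real.pi := by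
    calc e₂ * (Real.pi / (δ ^ 2 / 4)) ≤ δ ^ 2 * (Real.pi / (δ ^ 2 / 4)) := by gcongr
      _ = 4 * Real.pi := by field_simp
  linarith

theorem le_sq_of_rpow_mul_le_one {n : ℕ} {K δ e : ℝ} (hn : 1 ≤ n) (hδ : (n : ℝ) ^ (-K) ≤ δ)
    (h : (n : ℝ) ^ (2 * K) * e ≤ 1) : e ≤ δ ^ 2 := by
  have hn0 : (0 : ℝ) < n := by exact_mod_cast hn
  have hp : 0 < (n : ℝ) ^ (2 * K) := Real.rpow_pos_of_pos hn0 _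
  have h1 : ((n : ℝ) ^ (-K)) ^ 2 * (n : ℝ) ^ (2 * K) = 1 := by
    rw [← Real.rpow_mul_natCast hn0.le, ← Real.rpow_add hn0]
    norm_num
    ring_nf
    simp
  have h2 : ((n : ℝ) ^ (-K)) ^ 2 ≤ δ ^ 2 :=
    pow_le_pow_left₀ (Real.rpow_nonneg hn0.le _) hδ 2
  have h3 : e * (n : ℝ) ^ (2 * K) ≤ δ ^ 2 * (n : ℝ) ^ (2 * K) := by
    calc e * (n : ℝ) ^ (2 * K) ≤ 1 := by linarith
      _ = _ := h1.symm
      _ ≤ _ := by gcongr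
  exact le_of_mul_le_mul_right h3 hp

/-- Small ball estimate at smooth points for linear combinations with coefficients `coef`. -/
theorem exists_small_ball (κ K : ℝ) (hκ : 0 < κ) (hK : 0 < K) (c : ℝ≥0) :
    ∃ C : ℝ, 0 < C ∧ ∀ n : ℕ, 1 ≤ n → ∀ (Ω : Type*) [MeasurableSpace Ω] (P : Measure Ω)
      [IsProbabilityMeasure P] (ξ : ℤ → Ω → ℂ), iIndepFun ξ P →
      (∀ j, IdentDistrib (ξ j) (ξ 0) P P) → IsCoefficient (ξ 0) c P →
      ∀ t δ : ℝ, IsSmoothPoint n ((n : ℝ) ^ κ) t → (n : ℝ) ^ (-K) ≤ δ →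
      ∀ (a b : ℝ) (τ : ℂ), IsAmplitude a b → ‖τ‖ = 1 →
      P.real {ω | ‖∑ j ∈ Finset.Icc (-(n : ℤ)) n, coef n a b τ (t / n) j * ξ j ω‖ ≤ δ}
        ≤ C * δ ^ 2 := by
  have hB := symmScale_pos c
  set q := 1 / (2 * symmScale c ^ 2) with hq
  have hq0 : 0 < q := by positivity
  have hpi := Real.pi_pos
  -- The exponent `K + 2` covers frequencies up to `n ^ (K + 1)` multiplied by `symmScale c ≤ n`.
  obtain ⟨η, hη, hev⟩ := eventually_osc_bounds (K := K + 2) (r := 1 / (2 * symmScale c)) hκ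
    (by positivity)
  obtain ⟨N, hN⟩ := Filter.eventually_atTop.1 (hev.and
    ((eventually_rpow_mul_exp_neg_le_one (2 * K) (half_pos hκ)
        (show 0 < 4 * q * η by positivity)).and
      ((eventually_rpow_mul_exp_neg_le_one (2 * K) (σ := 2) (γ := 1 / 4) two_pos
        (by norm_num)).and
      (tendsto_natCast_atTop_atTop.eventually_ge_atTop (symmScale c)))))
  set C₁ := Real.exp (1 / 2) * (1 / (2 * Real.pi)) * (Real.pi / (q / 30720) + 6 * Real.pi)
    with hC₁
  have hC₁0 : 0 < C₁ := by positivity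
  -- The second summand handles `n < N`, where `δ ≥ N ^ (-K)` makes the bound at least `1`.
  refine ⟨C₁ + (N : ℝ) ^ (2 * K), by positivity, ?_⟩
  intro n hn Ω _ P _ ξ hind hid hξ t δ ht hδ a b τ hab hτ
  have hn0 : (0 : ℝ) < n := by exact_mod_cast hn
  have hδ0 : 0 < δ := (Real.rpow_pos_of_pos hn0 _).trans_le hδ
  rw [add_mul]
  rcases le_or_gt N n with hNn | hNn
  · obtain ⟨h1, h2, h3, h4⟩ := hN n hNn
    obtain ⟨hosc, hdist⟩ := h1 t ht a b hab
    set Z : Ω → ℂ := fun ω => ∑ j ∈ Finset.Icc (-(n : ℤ)) n, coef n a b τ (t / n) j * ξ j ω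
      with hZ
    have hZm : AEMeasurable Z P :=
      Finset.aemeasurable_fun_sum _ fun j _ => (hid j).aemeasurable_fst.const_mul _
    have hμ := Measure.isProbabilityMeasure_map hZm (μ := P)
    have hS : MeasurableSet {w : ℂ | ‖w‖ ≤ δ} :=
      (isClosed_le continuous_norm continuous_const).measurableSet
    have hPZ : P.real {ω | ‖Z ω‖ ≤ δ} = (P.map Z).real {w | ‖w‖ ≤ δ} := by
      rw [measureReal_def, measureReal_def, Measure.map_apply_of_aemeasurable hZm hS]
      rfl
    have hint := integral_le_of_gaussian_bound (β := q / 30720) (by positivity) hδ0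
      (le_sq_of_rpow_mul_le_one hn hδ h2) (le_sq_of_rpow_mul_le_one hn hδ h3)
      (g := fun u => Real.exp (-(δ ^ 2 / 2) * ‖u‖ ^ 2) * ‖charFun (P.map Z) u‖)
      (fun u => by positivity) (fun u => by
        have := exp_mul_norm_charFun_le hind hid hξ (T := η * (n : ℝ) ^ (κ / 2)) hn h4 hab hτ
          (by positivity) hδ hosc hdist u
        rw [← hq, ← mul_assoc (4 * q)] at this
        exact this)
    rw [hPZ]
    refine (measure_norm_le_le_integral_charFun (P.map Z) hδ0).trans ?_
    have h5 : Real.exp (1 / 2) * (δ ^ 2 / (2 * Real.pi)) *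
        ∫ u : ℂ, Real.exp (-(δ ^ 2 / 2) * ‖u‖ ^ 2) * ‖charFun (P.map Z) u‖ ≤ C₁ * δ ^ 2 := by
      calc _ ≤ Real.exp (1 / 2) * (δ ^ 2 / (2 * Real.pi)) *
            (Real.pi / (q / 30720) + 6 * Real.pi) := by gcongr
        _ = C₁ * δ ^ 2 := by rw [hC₁]; ring
    have : 0 ≤ (N : ℝ) ^ (2 * K) * δ ^ 2 := by positivity
    linarith
  · have hNn' : (n : ℝ) ≤ N := by exact_mod_cast hNn.le
    have hN0 : (0 : ℝ) < N := hn0.trans_le hNn'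
    have h1 : (N : ℝ) ^ (-K) ≤ δ :=
      (Real.rpow_le_rpow_of_nonpos hn0 hNn' (by linarith)).trans hδ
    have h2 : ((N : ℝ) ^ (2 * K))⁻¹ ≤ δ ^ 2 :=
      le_sq_of_rpow_mul_le_one (by omega) h1
        (mul_inv_cancel₀ (Real.rpow_pos_of_pos hN0 _).ne').le
    have h3 : 1 ≤ (N : ℝ) ^ (2 * K) * δ ^ 2 := by
      calc 1 = (N : ℝ) ^ (2 * K) * ((N : ℝ) ^ (2 * K))⁻¹ :=
            (mul_inv_cancel₀ (Real.rpow_pos_of_pos hN0 _).ne').symm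
        _ ≤ _ := by gcongr
    have h4 : 0 ≤ C₁ * δ ^ 2 := by positivity
    exact measureReal_le_one.trans (by linarith)

/-! ### The polynomial and its derivative as such sums. -/

theorem scaledTrigPoly_eq_sum_coef (n : ℕ) (x : ℤ → ℂ) (t : ℝ) :
    scaledTrigPoly n x t = ∑ j ∈ Finset.Icc (-(n : ℤ)) n, coef n 1 0 1 (t / n) j * x j := by
  rw [scaledTrigPoly, trigPoly, Finset.mul_sum]
  refine Finset.sum_congr rfl fun j _ => ?_
  rw [coef]
  push_cast
  ring

/-- Differentiating `e^{ijs/n}` produces the factor `i j / n`, hence the amplitude profile `j / n`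
and the unit factor `i`. -/
theorem hasDerivAt_scaledTrigPoly (n : ℕ) (x : ℤ → ℂ) (t : ℝ) :
    HasDerivAt (scaledTrigPoly n x)
      (∑ j ∈ Finset.Icc (-(n : ℤ)) n, coef n 0 1 Complex.I (t / n) j * x j) t := by
  have h : ∀ j : ℤ, HasDerivAt (fun s : ℝ => coef n 1 0 1 (s / n) j * x j)
      (coef n 0 1 Complex.I (t / n) j * x j) t := fun j => by
    have h1 : HasDerivAt (fun s : ℝ => Complex.I * ((j : ℂ) * ((s / n : ℝ) : ℂ)))
        (Complex.I * ((j : ℂ) * ((1 / n : ℝ) : ℂ))) t :=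
      ((((hasDerivAt_id t).div_const (n : ℝ)).ofReal_comp).const_mul (j : ℂ)).const_mul Complex.I
    have h2 := ((h1.cexp.const_mul (((1 + 0 * (j / n) : ℝ) : ℂ))).const_mul
      (1 * ((1 / Real.sqrt (2 * n + 1) : ℝ) : ℂ))).mul_const (x j)
    refine h2.congr_deriv ?_
    rw [coef]
    push_cast
    ring
  rw [show scaledTrigPoly n x = fun s => ∑ j ∈ Finset.Icc (-(n : ℤ)) n,
    coef n 1 0 1 (s / n) j * x j from funext fun s => scaledTrigPoly_eq_sum_coef n x s]
  exact HasDerivAt.fun_sum fun j _ => h j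

end SmallBall

end

theorem corollary3p4 (κ K : ℝ) (hκ : 0 < κ) (hK : 0 < K) (c : ℝ≥0) :
    ∃ C : ℝ, 0 < C ∧
      ∀ (n : ℕ), 1 ≤ n →
      ∀ (Ω : Type*) [MeasurableSpace Ω] (P : Measure Ω) [IsProbabilityMeasure P]
        (ξ : ℤ → Ω → ℂ),
        iIndepFun ξ P →
        (∀ j, IdentDistrib (ξ j) (ξ 0) P P) →
        SmallBall.IsCoefficient (ξ 0) c P →
      ∀ (t δ : ℝ), SmallBall.IsSmoothPoint n ((n : ℝ) ^ κ) t →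
        (n : ℝ) ^ (-K) ≤ δ → δ ≤ 1 →
        P.real {ω | ‖SmallBall.scaledTrigPoly n (fun j => ξ j ω) t‖ ≤ δ} ≤ C * δ ^ 2 ∧
        P.real {ω | ‖deriv (SmallBall.scaledTrigPoly n (fun j => ξ j ω)) t‖ ≤ δ} ≤ C * δ ^ 2 := by
  obtain ⟨C, hC, h⟩ := SmallBall.exists_small_ball κ K hκ hK c
  refine ⟨C, hC, fun n hn Ω _ P _ ξ hind hid hξ t δ ht hδ _ => ⟨?_, ?_⟩⟩
  · simp_rw [SmallBall.scaledTrigPoly_eq_sum_coef]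
    exact h n hn Ω P ξ hind hid hξ t δ ht hδ 1 0 1 (Or.inl ⟨rfl, rfl⟩) norm_one
  · simp_rw [(SmallBall.hasDerivAt_scaledTrigPoly n _ t).deriv]
    exact h n hn Ω P ξ hind hid hξ t δ ht hδ 0 1 Complex.I (Or.inr ⟨rfl, rfl⟩) Complex.norm_I
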